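/- **Terms.** Consider the untyped call-by-value $\lambda$-calculus with tuples, with terms $$t,u ::= x \mid t\,u \mid \pi_i t \mid \lambda(x_1,\dots,x_n).t \mid \langle t_1,\dots,t_n\rangle\qquad (n\ge 0),$$ where the variables of each abstracted sequence are pairwise distinct. The size is $|x|=1$, $|t\,u|=|t|+|u|+1$, $|\pi_i t|=|t|+1$, $|\lambda(x_1,\dots,x_n).t|=|t|+n+1$, $|\langle t_1,\dots,t_n\rangle|=n+\sum_i|t_i|$. The height $h(t)$ is the maximum number of bound variables of $t$ (counted with their binders) in the scope of which a sub-term of $t$ is contained, that is, $h(x)=0$, $h(t\,u)=\max(h(t),h(u))$, $h(\pi_i t)=h(t)$, $h(\lambda(x_1,\dots,x_n).t)=n+h(t)$, $h(\langle t_1,\dots,t_n\rangle)=\max_i h(t_i)$ (and $0$ for $n=0$). **The Source TAM.** Evaluated m-closures are $c ::= \bullet(\lambda\vec x.t,E)\mid \langle c_1,\dots,c_n\rangle$ with $n\ge 0$, local environments are lists $E ::= \epsilon\mid [x{\leftarrow}c]:E$, and $E(x)$ is the first entry for $x$ in $E$. A state is a pair $(f,S)$, where the active m-closure $f$ is either some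 $c$ or a non-evaluated $\circ(t,E)$, and the stack $S$ is a list of entries, each of which is an evaluated or non-evaluated m-closure, a projection $\pi_i$, or a partially evaluated tuple $(\langle t_1,\dots,t_k,\downarrow,c_1,\dots,c_m\rangle,E)$. The initial state of $t$ is $(\circ(t,\epsilon),\epsilon)$. The transitions are - $(\circ(t\,u,E),S)\to(\circ(u,E),\circ(t,E):S)$; - $(\circ(\pi_i t,E),S)\to(\circ(t,E),\pi_i:S)$; - $(\circ(\langle t_1,\dots,t_n\rangle,E),S)\to(\circ(t_n,E),(\langle t_1,\dots,t_{n-1},\downarrow\rangle,E):S)$ for $n\ge1$; - $(\circ(\langle\rangle,E),S)\to(\langle\rangle,S)$; - $(\circ(\lambda\vec x.t,E),S)\to(\bullet(\lambda\vec x.t,E),S)$; - $(\circ(x,E),S)\to(E(x),S)$ if $E(x)$ is defined; - $(c,\circ(t,E):S)\to(\circ(t,E),c:S)$; - $(c,(\langle \dots,t,\downarrow,\vec c\rangle,E):S)\to(\circ(t,E),(\langle\dots,\downarrow,c,\vec c\rangle,E):S)$; - $(c,(\langle\downarrow,\vec c\rangle,E):S)\to(\langle c,\vec c\rangle,S)$;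 - ($\beta$) $(\bullet(\lambda(x_1,\dots,x_n).t,E),\langle c_1,\dots,c_n\rangle:S)\to(\circ(t,[x_1{\leftarrow}c_1]:\dots:[x_n{\leftarrow}c_n]:E),S)$; - ($\pi$) $(\langle c_1,\dots,c_n\rangle,\pi_i:S)\to(c_i,S)$ if $1\le i\le n$. A state is final if no transition applies to it. A complete run from $t$ is a finite sequence of transitions $\rho$ from the initial state of $t$ to a final state; $|\rho|_\beta$ is its number of $\beta$ transitions. **RAMs.** A RAM has registers and an unbounded memory, all holding natural numbers. A program is a finite list of instructions: load a constant into a register, add, subtract (truncated at $0$), read or write the memory at the address held in a register, jump if a register is zero, halt. Each instruction costs one unit of time. States are represented in memory by pointer structures in which parts may be shared: terms are syntax trees, tuples are arrays of pointers, environments are arrays of pairs of a variable and a pointer to an m-closure, stacks are linked lists, and a partially evaluated tuple consists of an array of pointers to its remaining terms and a linked list of its computed m-closures. Initially, the memory holds a syntax tree of $t$, one register points to it, and another register holds an address above all of its cells; everything else is arbitrary. A program *implements $\rho$ in time $T$* if, from every such initial configuration, it passes through configurations that represent the successive states of $\rho$, at strictly increasing times, and has halted at the last of these times, which is at most $T$.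 **Theorem.** There are a RAM program $P$ and a constant $K$ such that, for every closed term $t$ and every complete Source TAM run $\rho$ from $t$, the program $P$ implements $\rho$ in time $$K\cdot(|\rho|_\beta+1)\cdot\max(1,|t|)\cdot\max(1,h(t)).$$ -/

import Mathlib

/-! ## The source calculus: call-by-value lambda terms with tuples -/

namespace SourceTAM

/-- Terms `x | t u | π_i t | λ(x₁,…,xₙ).t | ⟨t₁,…,tₙ⟩` (with `n ≥ 0`), with named variables and
without implicit renaming of bound variables: abstract machines work on the concrete terms. -/
inductive Term where
  | var (x : ℕ)
  | app (t u : Term)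
  | proj (i : ℕ) (t : Term)
  | lam (xs : List ℕ) (t : Term)
  | tup (ts : List Term)

namespace Term

mutual
/-- The set of free variables. -/
def fv : Term → Finset ℕ
  | var x => {x}
  | app t u => fv t ∪ fv u
  | proj _ t => fv t
  | lam xs t => fv t \ xs.toFinset
  | tup ts => fvList ts
/-- Union of the sets of free variables of the terms of a list. -/
def fvList : List Term → Finset ℕ
  | [] => ∅
  | t :: ts => fv t ∪ fvList ts
end

/-- Closed terms. -/
def Closed (t : Term) : Prop := t.fv = ∅

mutual
/-- Every abstracted sequence of variables consists of pairwise distinct variables. -/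
def Distinct : Term → Prop
  | var _ => True
  | app t u => Distinct t ∧ Distinct u
  | proj _ t => Distinct t
  | lam xs t => xs.Nodup ∧ Distinct t
  | tup ts => DistinctList ts
/-- `Distinct` for all the terms of a list. -/
def DistinctList : List Term → Prop
  | [] => True
  | t :: ts => Distinct t ∧ DistinctList ts
end

mutual
/-- The size `|t|`: `|x| = 1`, `|t u| = |t| + |u| + 1`, `|π_i t| = |t| + 1`,
`|λ(x₁,…,xₙ).t| = |t| + n + 1`, `|⟨t₁,…,tₙ⟩| = n + ∑ |tᵢ|`. -/
def size : Term → ℕ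
  | var _ => 1
  | app t u => size t + size u + 1
  | proj _ t => size t + 1
  | lam xs t => size t + xs.length + 1
  | tup ts => ts.length + sizeList ts
/-- Sum of the sizes of the terms of a list. -/
def sizeList : List Term → ℕ
  | [] => 0
  | t :: ts => size t + sizeList ts
end

mutual
/-- The height `h(t)`: the maximum number of bound variables of `t` in the scope of which a
sub-term of `t` is contained. -/
def height : Term → ℕ
  | var _ => 0
  | app t u => max (height t) (height u)
  | proj _ t => height t
  | lam xs t => xs.length + height t
  | tup ts => heightList ts
/-- Maximum of the heights of the terms of a list. -/
def heightList : List Term → ℕ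
  | [] => 0
  | t :: ts => max (height t) (heightList ts)
end

end Term

/-! ## The Source TAM -/

/-- Evaluated m-closures: an abstraction with a local environment, or a tuple of evaluated
m-closures. A local environment is a list of pairs of a variable and an evaluated m-closure. -/
inductive EClos where
  | abs (xs : List ℕ) (t : Term) (E : List (ℕ × EClos))
  | tup (cs : List EClos)

/-- Local environments, the most recent entry first. -/
abbrev Env := List (ℕ × EClos)

/-- Look-up `E(x)`: the first entry for `x`. -/
def Env.lookup : Env → ℕ → Option EClos
  | [], _ => none
  | (y, c) :: E, x => if y = x then some c else Env.lookup E x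

/-- Flagged m-closures: `ev c` is an evaluated one (black flag), `nev t E` is a non-evaluated term
with a local environment (white flag). -/
inductive FClos where
  | ev (c : EClos)
  | nev (t : Term) (E : Env)

/-- Stack entries: flagged m-closures, projections `π_i`, and partially evaluated tuples
`(⟨t₁,…,tₖ,↓,c₁,…,cₙ⟩, E)`, where `ts` is still to be evaluated (right to left). -/
inductive Entry where
  | clos (f : FClos)
  | proj (i : ℕ)
  | ptup (ts : List Term) (cs : List EClos) (E : Env)

/-- States: a flagged m-closure and a stack. -/
structure State where
  focus : FClos
  stack : List Entry

/-- The initial state of a term: the term, not evaluated, with empty environment and stack. -/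
def State.init (t : Term) : State := ⟨.nev t [], []⟩

/-- Names of transitions; `o` marks those on a non-evaluated m-closure, `e` those on an evaluated
one. -/
inductive Label where
  | oSea1 | oSea2 | oSea3 | oSea4 | oSea5 | oSub
  | eSea1 | eSea6 | eSea3 | beta | pi
  deriving DecidableEq

/-- The transitions of the Source TAM. -/
inductive Step : State → Label → State → Prop where
  | oSea1 (t u : Term) (E : Env) (S : List Entry) :
      Step ⟨.nev (.app t u) E, S⟩ .oSea1 ⟨.nev u E, .clos (.nev t E) :: S⟩
  | oSea2 (i : ℕ) (t : Term) (E : Env) (S : List Entry) :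
      Step ⟨.nev (.proj i t) E, S⟩ .oSea2 ⟨.nev t E, .proj i :: S⟩
  | oSea3 (us ts : List Term) (t : Term) (E : Env) (S : List Entry) (h : us = ts ++ [t]) :
      Step ⟨.nev (.tup us) E, S⟩ .oSea3 ⟨.nev t E, .ptup ts [] E :: S⟩
  | oSea4 (E : Env) (S : List Entry) :
      Step ⟨.nev (.tup []) E, S⟩ .oSea4 ⟨.ev (.tup []), S⟩
  | oSea5 (xs : List ℕ) (t : Term) (E : Env) (S : List Entry) :
      Step ⟨.nev (.lam xs t) E, S⟩ .oSea5 ⟨.ev (.abs xs t E), S⟩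
  | oSub (x : ℕ) (c : EClos) (E : Env) (S : List Entry) (h : E.lookup x = some c) :
      Step ⟨.nev (.var x) E, S⟩ .oSub ⟨.ev c, S⟩
  | eSea1 (c : EClos) (t : Term) (E : Env) (S : List Entry) :
      Step ⟨.ev c, .clos (.nev t E) :: S⟩ .eSea1 ⟨.nev t E, .clos (.ev c) :: S⟩
  | eSea6 (c : EClos) (us ts : List Term) (t : Term) (cs : List EClos) (E : Env)
      (S : List Entry) (h : us = ts ++ [t]) :
      Step ⟨.ev c, .ptup us cs E :: S⟩ .eSea6 ⟨.nev t E, .ptup ts (c :: cs) E :: S⟩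
  | eSea3 (c : EClos) (cs : List EClos) (E : Env) (S : List Entry) :
      Step ⟨.ev c, .ptup [] cs E :: S⟩ .eSea3 ⟨.ev (.tup (c :: cs)), S⟩
  | beta (xs : List ℕ) (t : Term) (E : Env) (cs : List EClos) (S : List Entry)
      (h : xs.length = cs.length) :
      Step ⟨.ev (.abs xs t E), .clos (.ev (.tup cs)) :: S⟩ .beta ⟨.nev t (xs.zip cs ++ E), S⟩
  | pi (i : ℕ) (cs : List EClos) (c : EClos) (S : List Entry)
      (hi : 1 ≤ i) (h : cs[i - 1]? = some c) :
      Step ⟨.ev (.tup cs), .proj i :: S⟩ .pi ⟨.ev c, S⟩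

/-- A state is final if no transition applies to it. -/
def State.Final (s : State) : Prop := ∀ (a : Label) (s' : State), ¬ Step s a s'

/-- Runs: possibly empty sequences of transitions. -/
inductive Run : State → State → Type where
  | nil (s : State) : Run s s
  | cons {s s' s'' : State} (a : Label) (h : Step s a s') (ρ : Run s' s'') : Run s s''

/-- The sequence of states visited by a run, both ends included. -/
def Run.states {s s' : State} : Run s s' → List State
  | .nil s => [s]
  | .cons (s := s) _ _ ρ => s :: ρ.states

/-- The length of a run. -/
def Run.length {s s' : State} : Run s s' → ℕ
  | .nil _ => 0
  | .cons _ _ ρ => ρ.length + 1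

/-- The number of beta transitions of a run. -/
def Run.numBeta {s s' : State} : Run s s' → ℕ
  | .nil _ => 0
  | .cons a _ ρ => ρ.numBeta + if a = Label.beta then 1 else 0

end SourceTAM

/-! ## Random access machines, with uniform cost -/

namespace RAM

/-- Instructions. A program addresses registers by constants, hence uses finitely many of them;
the memory is accessed through addresses that are held in registers. -/
inductive Instr where
  /-- `R_r := k` -/
  | const (r k : ℕ)
  /-- `R_r := R_p + R_q` -/
  | add (r p q : ℕ)
  /-- `R_r := R_p - R_q`, or `0` if this is negative -/
  | sub (r p q : ℕ)
  /-- `R_r := M[R_p]` -/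
  | load (r p : ℕ)
  /-- `M[R_r] := R_p` -/
  | store (r p : ℕ)
  /-- jump to instruction number `l` if `R_r = 0` -/
  | jz (r l : ℕ)
  | halt

/-- Programs: finite lists of instructions, numbered from `0`. -/
abbrev Program := List Instr

/-- Configurations: program counter, registers, memory. -/
structure Config where
  pc : ℕ
  reg : ℕ → ℕ
  mem : ℕ → ℕ

/-- The effect of one instruction. -/
def Instr.exec (c : Config) : Instr → Config
  | .const r k => ⟨c.pc + 1, Function.update c.reg r k, c.mem⟩
  | .add r p q => ⟨c.pc + 1, Function.update c.reg r (c.reg p + c.reg q), c.mem⟩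
  | .sub r p q => ⟨c.pc + 1, Function.update c.reg r (c.reg p - c.reg q), c.mem⟩
  | .load r p => ⟨c.pc + 1, Function.update c.reg r (c.mem (c.reg p)), c.mem⟩
  | .store r p => ⟨c.pc + 1, c.reg, Function.update c.mem (c.reg r) (c.reg p)⟩
  | .jz r l => ⟨if c.reg r = 0 then l else c.pc + 1, c.reg, c.mem⟩
  | .halt => c

/-- One step of a program; nothing happens if the program counter is out of range. -/
def Program.step (P : Program) (c : Config) : Config :=
  match P[c.pc]? with
  | some i => i.exec c
  | none => c

/-- The configuration after `n` steps; each step costs one unit of time. -/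
def Program.after (P : Program) (n : ℕ) (c : Config) : Config := (P.step)^[n] c

/-- The program has stopped: it is at a `halt` instruction or out of range. -/
def Program.Halted (P : Program) (c : Config) : Prop :=
  P[c.pc]? = none ∨ P[c.pc]? = some .halt

end RAM

/-! ## Source TAM states in RAM memory

All data structures are pointer structures, in which any parts may be shared. -/

namespace SourceTAM

/-- `TermAt m a t`: the memory `m` holds the syntax tree of `t` at address `a`. -/
inductive TermAt (m : ℕ → ℕ) : ℕ → Term → Prop where
  | var (a x : ℕ) (tag : m a = 0) (hx : m (a + 1) = x) : TermAt m a (.var x)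
  | app (a : ℕ) (t u : Term) (tag : m a = 1)
      (ht : TermAt m (m (a + 1)) t) (hu : TermAt m (m (a + 2)) u) : TermAt m a (.app t u)
  | proj (a i : ℕ) (t : Term) (tag : m a = 2) (hi : m (a + 1) = i)
      (ht : TermAt m (m (a + 2)) t) : TermAt m a (.proj i t)
  | lam (a : ℕ) (xs : List ℕ) (t : Term) (tag : m a = 3) (hlen : m (a + 1) = xs.length)
      (ht : TermAt m (m (a + 2)) t)
      (hxs : ∀ (i x : ℕ), xs[i]? = some x → m (a + 3 + i) = x) : TermAt m a (.lam xs t)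
  | tup (a : ℕ) (ts : List Term) (tag : m a = 4) (hlen : m (a + 1) = ts.length)
      (hts : ∀ (i : ℕ) (t : Term), ts[i]? = some t → TermAt m (m (a + 2 + i)) t) :
      TermAt m a (.tup ts)

/-- `EClosAt m a c`: the memory `m` holds the evaluated m-closure `c` at address `a`.
Environments are flat: arrays of pairs of a variable and a pointer to an m-closure, preceded by
their length. Tuples are arrays of pointers to m-closures. -/
inductive EClosAt (m : ℕ → ℕ) : ℕ → EClos → Prop where
  | abs (a : ℕ) (xs : List ℕ) (t : Term) (E : Env) (tag : m a = 0)
      (ht : TermAt m (m (a + 1)) (.lam xs t))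
      (hlen : m (m (a + 2)) = E.length)
      (hvar : ∀ (i x : ℕ) (c : EClos), E[i]? = some (x, c) → m (m (a + 2) + 1 + 2 * i) = x)
      (hclos : ∀ (i x : ℕ) (c : EClos), E[i]? = some (x, c) →
        EClosAt m (m (m (a + 2) + 2 + 2 * i)) c) :
      EClosAt m a (.abs xs t E)
  | tup (a : ℕ) (cs : List EClos) (tag : m a = 1) (hlen : m (a + 1) = cs.length)
      (hcs : ∀ (i : ℕ) (c : EClos), cs[i]? = some c → EClosAt m (m (a + 2 + i)) c) :
      EClosAt m a (.tup cs)

/-- `EnvAt m a E`: the memory `m` holds the (flat) environment `E` at address `a`. -/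
def EnvAt (m : ℕ → ℕ) (a : ℕ) (E : Env) : Prop :=
  m a = E.length ∧ ∀ (i x : ℕ) (c : EClos), E[i]? = some (x, c) →
    m (a + 1 + 2 * i) = x ∧ EClosAt m (m (a + 2 + 2 * i)) c

/-- `EClosListAt m a cs`: the memory `m` holds the linked list `cs` of m-closures at address `a`. -/
def EClosListAt (m : ℕ → ℕ) : ℕ → List EClos → Prop
  | a, [] => m a = 0
  | a, c :: cs => m a = 1 ∧ EClosListAt m (m (a + 1)) cs ∧ EClosAt m (m (a + 2)) c

/-- `StackAt m a S`: the memory `m` holds the stack `S`, a linked list, at address `a`. A cell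
holds its kind, a pointer to the next cell, and the data of the entry; the entry of a partially
evaluated tuple has an array of pointers to the terms still to be evaluated and a linked list of
the m-closures already computed. -/
def StackAt (m : ℕ → ℕ) : ℕ → List Entry → Prop
  | a, [] => m a = 0
  | a, .clos (.ev c) :: S => m a = 1 ∧ StackAt m (m (a + 1)) S ∧ EClosAt m (m (a + 2)) c
  | a, .clos (.nev t E) :: S => m a = 2 ∧ StackAt m (m (a + 1)) S ∧
      TermAt m (m (a + 2)) t ∧ EnvAt m (m (a + 3)) E
  | a, .proj i :: S => m a = 3 ∧ StackAt m (m (a + 1)) S ∧ m (a + 2) = i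
  | a, .ptup ts cs E :: S => m a = 4 ∧ StackAt m (m (a + 1)) S ∧ EnvAt m (m (a + 2)) E ∧
      m (a + 3) = ts.length ∧
      (∀ (i : ℕ) (t : Term), ts[i]? = some t → TermAt m (m (m (a + 4) + i)) t) ∧
      m (a + 5) = cs.length ∧ EClosListAt m (m (a + 6)) cs

/-- `Represents k s`: the RAM configuration `k` represents the state `s`. Register `0` holds the
flag, register `1` points to the active term or evaluated m-closure, register `2` to the
environment of the active term, register `3` to the stack. -/
def Represents (k : RAM.Config) : State → Prop
  | ⟨.nev t E, S⟩ => k.reg 0 = 0 ∧ TermAt k.mem (k.reg 1) t ∧ EnvAt k.mem (k.reg 2) E ∧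
      StackAt k.mem (k.reg 3) S
  | ⟨.ev c, S⟩ => k.reg 0 = 1 ∧ EClosAt k.mem (k.reg 1) c ∧ StackAt k.mem (k.reg 3) S

/-- `Loaded k t`: the RAM is about to start, with a syntax tree for `t`, stored in memory cells
below the address in register `4`, at the address in register `1`. That the tree lies in these
cells is expressed by the fact that changing the other cells does not affect it. All
other registers and memory cells have arbitrary contents. -/
def Loaded (k : RAM.Config) (t : Term) : Prop :=
  k.pc = 0 ∧ ∀ m : ℕ → ℕ, (∀ i < k.reg 4, m i = k.mem i) → TermAt m (k.reg 1) t

/-- The program `P` implements the run `ρ` from the initial state of `t` within time `T`: from any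
configuration in which `t` is loaded, there are times `τ 0 < τ 1 < ⋯ < τ |ρ| ≤ T` such that the
RAM represents the `i`-th state of `ρ` at time `τ i`, and has stopped at time `τ |ρ|`. -/
def ImplementsWithin (P : RAM.Program) {t : Term} {s : State} (ρ : Run (State.init t) s)
    (T : ℕ) : Prop :=
  ∀ k : RAM.Config, Loaded k t → ∃ τ : ℕ → ℕ,
    (∀ i < ρ.length, τ i < τ (i + 1)) ∧
    (∀ (i : ℕ) (r : State), ρ.states[i]? = some r → Represents (P.after (τ i) k) r) ∧
    P.Halted (P.after (τ ρ.length) k) ∧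
    τ ρ.length ≤ T

end SourceTAM

/-! ## Reachability in RAM programs -/

namespace RAM

-- The program `interpreter` keeps environments as flat arrays and only allocates: every write goes
-- to an address at or above the frontier in register `4`, which never decreases. A structure whose
-- cells all lie below the frontier therefore survives every later step and can be shared freely.
-- This is why each `…At` predicate has a bounded version `…In` and an `extend` lemma.
--
-- Each transition is simulated by symbolic execution (`Step.continues`) in at most `14 * loops +
-- 100` machine steps after the first. Here `loops` counts the entries handled by a variable
-- look-up, by the construction of the environment in a β transition, or by the assembly of a tuple,
-- and is zero otherwise.
--
-- The total is bounded by amortization. By the invariant `Step.fits`, every term in the state has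
-- size at most `N = |t|`, and the length of its environment plus its height is at most `H = h(t)`.
-- Hence look-ups and β transitions handle at most `H` entries. Tuples may be longer than that, but
-- each computed component leaves a unit of credit in the potential `State.weight`, and these units
-- pay for the final copy. The potential drops at every transition except β, which may raise it by a
-- linear function of `N`, since the body it enters is a term of size at most `N`. With each unit
-- worth `H + 1`, `Step.loops_le` says that the potential pays for both the transitions and their
-- loops; `Run.implemented` sums this along the run.
--
-- In a final state the program still has to discover that no transition applies. It does so using
-- scratch registers only, so the halted configuration still represents that state (`Ready.stops`).

/-- Within `B` steps, `P` takes the configuration `c` to one that satisfies `Q`. -/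
def Program.Reaches (P : Program) (B : ℕ) (c : Config) (Q : Config → Prop) : Prop :=
  ∃ n ≤ B, Q (P.after n c)

namespace Program

variable {P : Program} {B B' : ℕ} {c : Config} {Q Q' : Config → Prop}

theorem after_add (P : Program) (m n : ℕ) (c : Config) :
    P.after (m + n) c = P.after n (P.after m c) := by
  rw [after, after, after, Nat.add_comm, Function.iterate_add_apply]

theorem Reaches.done (h : Q c) : P.Reaches B c Q := ⟨0, Nat.zero_le _, h⟩

theorem Reaches.mono (h : P.Reaches B c Q) (hB : B ≤ B') : P.Reaches B' c Q := by
  obtain ⟨n, hn, hQ⟩ := h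
  exact ⟨n, hn.trans hB, hQ⟩

theorem Reaches.bind (h : P.Reaches B c Q) (h' : ∀ d, Q d → P.Reaches B' d Q') :
    P.Reaches (B + B') c Q' := by
  obtain ⟨n, hn, hQ⟩ := h
  obtain ⟨n', hn', hQ'⟩ := h' _ hQ
  exact ⟨n + n', by omega, by rwa [after_add]⟩

theorem step_eq {pc : ℕ} {r m : ℕ → ℕ} {i : Instr} (hi : P[pc]? = some i) :
    P.step ⟨pc, r, m⟩ = i.exec ⟨pc, r, m⟩ := by
  simp [step, hi]

/-- The rule of symbolic execution: for a concrete program counter the premise `hi` is closed by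
`rfl`, and each instruction consumes one unit of the budget. -/
theorem Reaches.instr {pc : ℕ} {r m : ℕ → ℕ} {i : Instr} (hi : P[pc]? = some i)
    (h : P.Reaches B (i.exec ⟨pc, r, m⟩) Q) : P.Reaches (B + 1) ⟨pc, r, m⟩ Q := by
  obtain ⟨n, hn, hQ⟩ := h
  refine ⟨n + 1, by omega, ?_⟩
  rwa [after, Function.iterate_succ_apply, step_eq hi]

/-- Splitting off the first step makes the elapsed time positive, which is what makes the
representation times strictly increasing. -/
theorem Reaches.pos_of_step (h : P.Reaches B (P.step c) Q) :
    ∃ n, 0 < n ∧ n ≤ B + 1 ∧ Q (P.after n c) := by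
  obtain ⟨n, hn, hQ⟩ := h
  exact ⟨n + 1, by omega, by omega, by rwa [after, Function.iterate_succ_apply]⟩

end Program

end RAM

namespace SourceTAM

open RAM RAM.Program

/-- A RAM program that executes the Source TAM. It goes through instruction `12` with a
non-evaluated active m-closure and through instruction `101` with an evaluated one. Register `4`
holds the first free memory address, registers `5` to `11` the constants `0` to `6`, and the
following ones are scratch registers. -/
def interpreter : RAM.Program := [
  -- set-up: constants 0..6 in registers 5..11, empty environment and stack
  .const 5 0, .const 6 1, .const 7 2, .const 8 3, .const 9 4, .const 10 5, .const 11 6,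
  .store 4 5, .add 2 4 5, .add 3 4 5, .add 4 4 6, .const 0 0,
  -- dispatch on the tag of a non-evaluated term
  .load 12 1, .jz 12 85, .sub 12 12 6, .jz 12 50, .sub 12 12 6, .jz 12 64, .sub 12 12 6,
  .jz 12 76,
  -- tuple
  .add 13 1 6, .load 13 13, .jz 13 43,
  .sub 13 13 6, .add 14 1 7, .add 15 14 13, .load 1 15,
  .store 4 9, .add 12 4 6, .store 12 3, .add 12 4 7, .store 12 2, .add 12 4 8, .store 12 13,
  .add 12 4 9, .store 12 14, .add 15 4 10, .store 15 5, .add 12 4 11, .store 12 15,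
  .add 3 4 5, .add 4 15 7, .jz 5 12,
  -- empty tuple
  .store 4 6, .add 12 4 6, .store 12 5, .add 1 4 5, .add 4 4 7, .const 0 1, .jz 5 101,
  -- application
  .add 12 1 6, .load 13 12, .add 12 1 7, .load 1 12,
  .store 4 7, .add 12 4 6, .store 12 3, .add 12 4 7, .store 12 13, .add 12 4 8, .store 12 2,
  .add 3 4 5, .add 4 4 9, .jz 5 12,
  -- projection
  .add 12 1 6, .load 13 12, .add 12 1 7, .load 1 12,
  .store 4 8, .add 12 4 6, .store 12 3, .add 12 4 7, .store 12 13,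
  .add 3 4 5, .add 4 4 8, .jz 5 12,
  -- abstraction
  .store 4 5, .add 12 4 6, .store 12 1, .add 12 4 7, .store 12 2,
  .add 1 4 5, .add 4 4 8, .const 0 1, .jz 5 101,
  -- variable: search the environment
  .add 12 1 6, .load 12 12, .load 13 2, .add 14 2 6,
  .jz 13 205, .load 15 14, .sub 16 15 12, .sub 17 12 15, .add 16 16 17, .jz 16 98,
  .add 14 14 7, .sub 13 13 6, .jz 5 89,
  .add 14 14 6, .load 1 14, .const 0 1,
  -- dispatch on the tag of the stack
  .load 12 3, .jz 12 205, .sub 12 12 6, .jz 12 203, .sub 12 12 6, .jz 12 172, .sub 12 12 6,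
  .jz 12 188,
  -- partially evaluated tuple
  .add 12 3 8, .load 13 12, .jz 13 149,
  .add 12 3 6, .load 14 12, .add 12 3 7, .load 2 12, .add 12 3 9, .load 15 12, .add 12 3 10,
  .load 16 12, .add 12 3 11, .load 17 12,
  .sub 13 13 6, .add 12 15 13, .load 18 12,
  .store 4 6, .add 12 4 6, .store 12 17, .add 12 4 7, .store 12 1,
  .add 1 18 5, .add 3 4 8, .store 3 9, .add 12 3 6, .store 12 14, .add 12 3 7, .store 12 2,
  .add 12 3 8, .store 12 13,
  .add 12 3 9, .store 12 15, .add 12 3 10, .add 16 16 6, .store 12 16, .add 12 3 11, .store 12 4,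
  .add 4 12 6, .const 0 0, .jz 5 12,
  -- complete tuple: copy the list of its m-closures into an array
  .add 12 3 10, .load 13 12, .add 12 3 11, .load 14 12, .add 12 3 6, .load 3 12,
  .store 4 6, .add 12 4 6, .add 15 13 6, .store 12 15, .add 12 4 7, .store 12 1, .add 1 4 5,
  .add 4 12 6,
  .jz 13 101,
  .add 12 14 7, .load 15 12, .store 4 15, .add 12 14 6, .load 14 12, .add 4 4 6, .sub 13 13 6,
  .jz 5 163,
  -- non-evaluated m-closure on the stack
  .add 12 3 6, .load 13 12, .add 12 3 8, .load 2 12, .add 12 3 7, .load 14 12,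
  .store 4 6, .add 12 4 6, .store 12 13, .add 12 4 7, .store 12 1,
  .add 1 14 5, .add 3 4 5, .add 4 4 8, .const 0 0, .jz 5 12,
  -- projection on the stack
  .load 12 1, .jz 12 205, .add 12 3 7, .load 13 12, .jz 13 205, .add 12 1 6, .load 14 12,
  .sub 14 13 14, .jz 14 198, .jz 5 205,
  .add 12 12 13, .load 1 12, .add 12 3 6, .load 3 12, .jz 5 101,
  -- evaluated m-closure on the stack
  .load 12 1, .jz 12 206,
  .halt,
  .add 12 3 7, .load 13 12, .load 12 13, .jz 12 205,
  .add 12 1 6, .load 14 12, .add 12 14 6, .load 15 12, .add 12 13 6, .load 16 12,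
  .sub 17 15 16, .sub 16 16 15, .add 16 16 17, .jz 16 221, .jz 5 205,
  .add 12 3 6, .load 3 12, .add 12 1 7, .load 17 12, .load 18 17, .add 12 14 7, .load 1 12,
  .add 12 15 18, .store 4 12, .add 2 4 5, .add 4 4 6, .add 14 14 8, .add 13 13 7,
  .jz 15 245,
  .load 12 14, .store 4 12, .add 4 4 6, .load 12 13, .store 4 12, .add 4 4 6, .add 14 14 6,
  .add 13 13 6, .sub 15 15 6, .jz 5 234,
  .add 17 17 6, .add 18 18 18,
  .jz 18 254,
  .load 12 17, .store 4 12, .add 4 4 6, .add 17 17 6, .sub 18 18 6, .jz 5 247,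
  .const 0 0, .jz 5 12]

/-! ## Data structures that lie below a frontier -/

/-- As `TermAt`, with all cells of the tree at addresses smaller than `F`. -/
inductive TermIn (F : ℕ) (m : ℕ → ℕ) : ℕ → Term → Prop where
  | var (a x : ℕ) (lt : a + 1 < F) (tag : m a = 0) (hx : m (a + 1) = x) : TermIn F m a (.var x)
  | app (a : ℕ) (t u : Term) (lt : a + 2 < F) (tag : m a = 1)
      (ht : TermIn F m (m (a + 1)) t) (hu : TermIn F m (m (a + 2)) u) : TermIn F m a (.app t u)
  | proj (a i : ℕ) (t : Term) (lt : a + 2 < F) (tag : m a = 2) (hi : m (a + 1) = i)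
      (ht : TermIn F m (m (a + 2)) t) : TermIn F m a (.proj i t)
  | lam (a : ℕ) (xs : List ℕ) (t : Term) (lt : a + 2 + xs.length < F) (tag : m a = 3)
      (hlen : m (a + 1) = xs.length) (ht : TermIn F m (m (a + 2)) t)
      (hxs : ∀ (i x : ℕ), xs[i]? = some x → m (a + 3 + i) = x) : TermIn F m a (.lam xs t)
  | tup (a : ℕ) (ts : List Term) (lt : a + 1 + ts.length < F) (tag : m a = 4)
      (hlen : m (a + 1) = ts.length)
      (hts : ∀ (i : ℕ) (t : Term), ts[i]? = some t → TermIn F m (m (a + 2 + i)) t) :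
      TermIn F m a (.tup ts)

/-- As `EClosAt`, with all cells at addresses smaller than `F`. -/
inductive EClosIn (F : ℕ) (m : ℕ → ℕ) : ℕ → EClos → Prop where
  | abs (a : ℕ) (xs : List ℕ) (t : Term) (E : Env) (lt : a + 2 < F) (tag : m a = 0)
      (ht : TermIn F m (m (a + 1)) (.lam xs t))
      (ltE : m (a + 2) + 2 * E.length < F) (hlen : m (m (a + 2)) = E.length)
      (hvar : ∀ (i x : ℕ) (c : EClos), E[i]? = some (x, c) → m (m (a + 2) + 1 + 2 * i) = x)
      (hclos : ∀ (i x : ℕ) (c : EClos), E[i]? = some (x, c) →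
        EClosIn F m (m (m (a + 2) + 2 + 2 * i)) c) :
      EClosIn F m a (.abs xs t E)
  | tup (a : ℕ) (cs : List EClos) (lt : a + 1 + cs.length < F) (tag : m a = 1)
      (hlen : m (a + 1) = cs.length)
      (hcs : ∀ (i : ℕ) (c : EClos), cs[i]? = some c → EClosIn F m (m (a + 2 + i)) c) :
      EClosIn F m a (.tup cs)

/-- As `EnvAt`, with all cells at addresses smaller than `F`. -/
def EnvIn (F : ℕ) (m : ℕ → ℕ) (a : ℕ) (E : Env) : Prop :=
  a + 2 * E.length < F ∧ m a = E.length ∧ ∀ (i x : ℕ) (c : EClos), E[i]? = some (x, c) →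
    m (a + 1 + 2 * i) = x ∧ EClosIn F m (m (a + 2 + 2 * i)) c

/-- As `EClosListAt`, with all cells at addresses smaller than `F`. -/
def EClosListIn (F : ℕ) (m : ℕ → ℕ) : ℕ → List EClos → Prop
  | a, [] => a < F ∧ m a = 0
  | a, c :: cs => a + 2 < F ∧ m a = 1 ∧ EClosListIn F m (m (a + 1)) cs ∧ EClosIn F m (m (a + 2)) c

/-- As `StackAt`, with all cells at addresses smaller than `F`. -/
def StackIn (F : ℕ) (m : ℕ → ℕ) : ℕ → List Entry → Prop
  | a, [] => a < F ∧ m a = 0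
  | a, .clos (.ev c) :: S => a + 2 < F ∧ m a = 1 ∧ StackIn F m (m (a + 1)) S ∧
      EClosIn F m (m (a + 2)) c
  | a, .clos (.nev t E) :: S => a + 3 < F ∧ m a = 2 ∧ StackIn F m (m (a + 1)) S ∧
      TermIn F m (m (a + 2)) t ∧ EnvIn F m (m (a + 3)) E
  | a, .proj i :: S => a + 2 < F ∧ m a = 3 ∧ StackIn F m (m (a + 1)) S ∧ m (a + 2) = i
  | a, .ptup ts cs E :: S => a + 6 < F ∧ m a = 4 ∧ StackIn F m (m (a + 1)) S ∧
      EnvIn F m (m (a + 2)) E ∧ m (a + 3) = ts.length ∧ m (a + 4) + ts.length ≤ F ∧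
      (∀ (i : ℕ) (t : Term), ts[i]? = some t → TermIn F m (m (m (a + 4) + i)) t) ∧
      m (a + 5) = cs.length ∧ EClosListIn F m (m (a + 6)) cs

-- Dropping the address bounds

section Forget

variable {F : ℕ} {m : ℕ → ℕ} {a : ℕ}

theorem TermIn.termAt {t : Term} (h : TermIn F m a t) : TermAt m a t := by
  induction h with
  | var a x lt tag hx => exact .var a x tag hx
  | app a t u lt tag ht hu iht ihu => exact .app a t u tag iht ihu
  | proj a i t lt tag hi ht iht => exact .proj a i t tag hi iht
  | lam a xs t lt tag hlen ht hxs iht => exact .lam a xs t tag hlen iht hxs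
  | tup a ts lt tag hlen hts ihts => exact .tup a ts tag hlen ihts

theorem EClosIn.eClosAt {c : EClos} (h : EClosIn F m a c) : EClosAt m a c := by
  induction h with
  | abs a xs t E lt tag ht ltE hlen hvar hclos ih =>
    exact .abs a xs t E tag ht.termAt hlen hvar ih
  | tup a cs lt tag hlen hcs ih => exact .tup a cs tag hlen ih

theorem EnvIn.envAt {E : Env} (h : EnvIn F m a E) : EnvAt m a E :=
  ⟨h.2.1, fun i x c hi => ⟨(h.2.2 i x c hi).1, (h.2.2 i x c hi).2.eClosAt⟩⟩

theorem EClosListIn.eClosListAt {cs : List EClos} :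
    ∀ {a : ℕ}, EClosListIn F m a cs → EClosListAt m a cs := by
  induction cs with
  | nil => exact fun h => h.2
  | cons c cs ih => exact fun h => ⟨h.2.1, ih h.2.2.1, h.2.2.2.eClosAt⟩

theorem StackIn.stackAt {S : List Entry} : ∀ {a : ℕ}, StackIn F m a S → StackAt m a S := by
  induction S with
  | nil => exact fun h => h.2
  | cons e S ih =>
    match e with
    | .clos (.ev c) => exact fun {_} ⟨_, h1, h2, h3⟩ => ⟨h1, ih h2, h3.eClosAt⟩
    | .clos (.nev t E) => exact fun {_} ⟨_, h1, h2, h3, h4⟩ => ⟨h1, ih h2, h3.termAt, h4.envAt⟩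
    | .proj i => exact fun {_} ⟨_, h1, h2, h3⟩ => ⟨h1, ih h2, h3⟩
    | .ptup ts cs E =>
      exact fun {_} ⟨_, h1, h2, h3, h4, _, h5, h6, h7⟩ =>
        ⟨h1, ih h2, h3.envAt, h4, fun i t hi => (h5 i t hi).termAt, h6, h7.eClosListAt⟩

end Forget

-- Persistence of structures when memory is allocated

section Extend

variable {F F' : ℕ} {m m' : ℕ → ℕ} {a : ℕ}

/-- Every cell that the predicate reads lies below `F`, where the two memories agree. The analogues
for closures, environments, lists and stacks hold for the same reason. -/
theorem TermIn.extend {t : Term} (h : TermIn F m a t) (hF : F ≤ F')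
    (hm : ∀ i < F, m' i = m i) : TermIn F' m' a t := by
  induction h with
  | var a x lt tag hx =>
    exact .var a x (by omega) (by rwa [hm _ (by omega)]) (by rwa [hm _ (by omega)])
  | app a t u lt tag ht hu iht ihu =>
    exact .app a t u (by omega) (by rwa [hm _ (by omega)]) (by rwa [hm _ (by omega)])
      (by rwa [hm _ (by omega)])
  | proj a i t lt tag hi ht iht =>
    exact .proj a i t (by omega) (by rwa [hm _ (by omega)]) (by rwa [hm _ (by omega)])
      (by rwa [hm _ (by omega)])
  | lam a xs t lt tag hlen ht hxs iht =>
    refine .lam a xs t (by omega) (by rwa [hm _ (by omega)]) (by rwa [hm _ (by omega)])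
      (by rwa [hm _ (by omega)]) fun i x hi => ?_
    have := (List.getElem?_eq_some_iff.1 hi).1
    rw [hm _ (by omega), hxs i x hi]
  | tup a ts lt tag hlen hts ihts =>
    refine .tup a ts (by omega) (by rwa [hm _ (by omega)]) (by rwa [hm _ (by omega)])
      fun i x hi => ?_
    have := (List.getElem?_eq_some_iff.1 hi).1
    rw [hm _ (by omega)]
    exact ihts i x hi

theorem EClosIn.extend {c : EClos} (h : EClosIn F m a c) (hF : F ≤ F')
    (hm : ∀ i < F, m' i = m i) : EClosIn F' m' a c := by
  induction h with
  | abs a xs t E lt tag ht ltE hlen hvar hclos ih =>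
    have h1 : m' (a + 1) = m (a + 1) := hm _ (by omega)
    have h2 : m' (a + 2) = m (a + 2) := hm _ (by omega)
    refine .abs a xs t E (by omega) (by rwa [hm _ (by omega)]) (h1 ▸ ht.extend hF hm) (by omega)
      (by rwa [h2, hm _ (by omega)]) (fun i x c hi => ?_) (fun i x c hi => ?_)
    all_goals have := (List.getElem?_eq_some_iff.1 hi).1
    · rw [h2, hm _ (by omega), hvar i x c hi]
    · rw [h2, hm _ (by omega)]
      exact ih i x c hi
  | tup a cs lt tag hlen hcs ih =>
    refine .tup a cs (by omega) (by rwa [hm _ (by omega)]) (by rwa [hm _ (by omega)])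
      fun i x hi => ?_
    have := (List.getElem?_eq_some_iff.1 hi).1
    rw [hm _ (by omega)]
    exact ih i x hi

theorem EnvIn.extend {E : Env} (h : EnvIn F m a E) (hF : F ≤ F')
    (hm : ∀ i < F, m' i = m i) : EnvIn F' m' a E := by
  obtain ⟨h1, h2, h3⟩ := h
  refine ⟨by omega, by rwa [hm _ (by omega)], fun i x c hi => ?_⟩
  have := (List.getElem?_eq_some_iff.1 hi).1
  rw [hm _ (by omega), hm _ (by omega)]
  exact ⟨(h3 i x c hi).1, (h3 i x c hi).2.extend hF hm⟩

theorem EClosListIn.extend {cs : List EClos} (hF : F ≤ F') (hm : ∀ i < F, m' i = m i) :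
    ∀ {a : ℕ}, EClosListIn F m a cs → EClosListIn F' m' a cs := by
  induction cs with
  | nil => exact fun ⟨h1, h2⟩ => ⟨by omega, by rwa [hm _ h1]⟩
  | cons c cs ih =>
    intro a ⟨h1, h2, h3, h4⟩
    refine ⟨by omega, ?_⟩
    rw [hm _ (by omega), hm _ (by omega), hm _ (by omega)]
    exact ⟨h2, ih h3, h4.extend hF hm⟩

theorem StackIn.extend {S : List Entry} (hF : F ≤ F') (hm : ∀ i < F, m' i = m i) :
    ∀ {a : ℕ}, StackIn F m a S → StackIn F' m' a S := by
  induction S with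
  | nil => exact fun ⟨h1, h2⟩ => ⟨by omega, by rwa [hm _ h1]⟩
  | cons e S ih =>
    match e with
    | .clos (.ev c) =>
      intro a ⟨h, h1, h2, h3⟩
      refine ⟨by omega, ?_⟩
      rw [hm _ (by omega), hm _ (by omega), hm _ (by omega)]
      exact ⟨h1, ih h2, h3.extend hF hm⟩
    | .clos (.nev t E) =>
      intro a ⟨h, h1, h2, h3, h4⟩
      refine ⟨by omega, ?_⟩
      rw [hm _ (by omega), hm _ (by omega), hm _ (by omega), hm _ (by omega)]
      exact ⟨h1, ih h2, h3.extend hF hm, h4.extend hF hm⟩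
    | .proj i =>
      intro a ⟨h, h1, h2, h3⟩
      refine ⟨by omega, ?_⟩
      rw [hm _ (by omega), hm _ (by omega), hm _ (by omega)]
      exact ⟨h1, ih h2, h3⟩
    | .ptup ts cs E =>
      intro a ⟨h, h1, h2, h3, h4, h5, h6, h7, h8⟩
      refine ⟨by omega, ?_⟩
      rw [hm _ (by omega), hm _ (by omega), hm _ (by omega), hm _ (by omega), hm (a + 4) (by omega),
        hm (a + 5) (by omega), hm (a + 6) (by omega)]
      refine ⟨h1, ih h2, h3.extend hF hm, h4, by omega, fun i t hi => ?_, h7, h8.extend hF hm⟩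
      have := (List.getElem?_eq_some_iff.1 hi).1
      rw [hm _ (by omega)]
      exact (h6 i t hi).extend hF hm

end Extend

/-- A syntax tree occupies cells below `F` if it does not depend on the other cells. -/
theorem TermIn.of_forall {F : ℕ} {m : ℕ → ℕ} {a : ℕ} {t : Term}
    (h : ∀ m' : ℕ → ℕ, (∀ i < F, m' i = m i) → TermAt m' a t) : TermIn F m a t := by
  have upd (b v : ℕ) (hb : F ≤ b) : ∀ i < F, Function.update m b v i = m i :=
    fun i hi => Function.update_of_ne (by omega) _ _
  -- A pointer to a term lies below the frontier.
  have ptr (b : ℕ) (t : Term) (hb : ∀ m' : ℕ → ℕ, (∀ i < F, m' i = m i) → TermAt m' (m' b) t) :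
      b < F := by
    by_contra hF
    -- If `b` were not below `F`, it could be redirected to `b + 1`, whose tag could be set to `5`;
    -- no term has that tag.
    have h5 := hb (Function.update (Function.update m b (b + 1)) (b + 1) 5) fun i hi => by
      rw [Function.update_of_ne (by omega), Function.update_of_ne (by omega)]
    rw [Function.update_of_ne (by omega), Function.update_self] at h5
    cases h5 <;> simp_all
  have head (b : ℕ) (t : Term) (hb : ∀ m' : ℕ → ℕ, (∀ i < F, m' i = m i) → TermAt m' b t) :
      b < F := by
    by_contra hF
    have h5 := hb _ (upd b 5 (by omega))
    cases h5 <;> simp_all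
  have cell (b v : ℕ) (hb : ∀ m' : ℕ → ℕ, (∀ i < F, m' i = m i) → m' b = v) : b < F := by
    by_contra hF
    simpa [hb m fun _ _ => rfl] using hb _ (upd b (m b + 1) (by omega))
  -- As the pointer cell itself is fixed, independence of the other cells passes to the subterm at
  -- the constant address `m b`, as the induction hypotheses require.
  have fix (b : ℕ) (t : Term) (hb : ∀ m' : ℕ → ℕ, (∀ i < F, m' i = m i) → TermAt m' (m' b) t)
      (m' : ℕ → ℕ) (hm' : ∀ i < F, m' i = m i) : TermAt m' (m b) t :=
    hm' b (ptr b t hb) ▸ hb m' hm'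
  have h0 := h m fun _ _ => rfl
  induction h0 with
  | var a x tag hx =>
    exact .var a x (cell _ x fun m' hm' => by cases h m' hm'; assumption) tag hx
  | app a t u tag ht hu iht ihu =>
    have h1 : ∀ m' : ℕ → ℕ, (∀ i < F, m' i = m i) → TermAt m' (m' (a + 1)) t :=
      fun m' hm' => by cases h m' hm'; assumption
    have h2 : ∀ m' : ℕ → ℕ, (∀ i < F, m' i = m i) → TermAt m' (m' (a + 2)) u :=
      fun m' hm' => by cases h m' hm'; assumption
    exact .app a t u (ptr _ _ h2) tag (iht (fix _ _ h1)) (ihu (fix _ _ h2))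
  | proj a i t tag hi ht iht =>
    have h1 : ∀ m' : ℕ → ℕ, (∀ i < F, m' i = m i) → TermAt m' (m' (a + 2)) t :=
      fun m' hm' => by cases h m' hm'; assumption
    exact .proj a i t (ptr _ _ h1) tag hi (iht (fix _ _ h1))
  | lam a xs t tag hlen ht hxs iht =>
    have h1 : ∀ m' : ℕ → ℕ, (∀ i < F, m' i = m i) → TermAt m' (m' (a + 2)) t :=
      fun m' hm' => by cases h m' hm'; assumption
    have h2 : ∀ i x : ℕ, xs[i]? = some x → a + 3 + i < F := fun i x hi =>
      cell _ x fun m' hm' => by cases h m' hm' with | lam _ _ _ _ _ _ hxs => exact hxs i x hi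
    refine .lam a xs t ?_ tag hlen (iht (fix _ _ h1)) hxs
    -- The last cell of the node is the pointer to the body if no variable is bound, and otherwise
    -- holds the last variable.
    rcases Nat.eq_zero_or_pos xs.length with h0 | h0
    · rw [h0]
      exact ptr _ _ h1
    · have := h2 _ _ (List.getElem?_eq_getElem (i := xs.length - 1) (by omega))
      omega
  | tup a ts tag hlen hts ihts =>
    have h1 : ∀ m' : ℕ → ℕ, (∀ i < F, m' i = m i) → m' (a + 1) = ts.length :=
      fun m' hm' => by cases h m' hm'; assumption
    have h2 : ∀ (i : ℕ) (t : Term), ts[i]? = some t → ∀ m' : ℕ → ℕ, (∀ i < F, m' i = m i) →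
        TermAt m' (m' (a + 2 + i)) t := fun i t hi m' hm' => by
      cases h m' hm' with | tup _ _ _ _ hts => exact hts i t hi
    refine .tup a ts ?_ tag hlen fun i t hi => ihts i t hi (fix _ _ (h2 i t hi))
    rcases Nat.eq_zero_or_pos ts.length with h0 | h0
    · rw [h0]
      exact cell _ _ h1
    · have := ptr _ _ (h2 _ _ (List.getElem?_eq_getElem (i := ts.length - 1) (by omega)))
      omega

/-! ## The interpreter simulates the transitions -/

/-- The contents of the constant registers of the interpreter. -/
def ConstRegs (r : ℕ → ℕ) : Prop :=
  r 5 = 0 ∧ r 6 = 1 ∧ r 7 = 2 ∧ r 8 = 3 ∧ r 9 = 4 ∧ r 10 = 5 ∧ r 11 = 6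

theorem ConstRegs.congr {r r' : ℕ → ℕ} (h : ConstRegs r) (hr : ∀ j < 12, r' j = r j) :
    ConstRegs r' := by
  simpa [ConstRegs, hr] using h

/-- The configuration is one in which the interpreter starts to treat the given state. -/
def Ready : State → RAM.Config → Prop
  | ⟨.nev t E, S⟩, k => k.pc = 12 ∧ ConstRegs k.reg ∧ k.reg 0 = 0 ∧
      TermIn (k.reg 4) k.mem (k.reg 1) t ∧ EnvIn (k.reg 4) k.mem (k.reg 2) E ∧
      StackIn (k.reg 4) k.mem (k.reg 3) S
  | ⟨.ev c, S⟩, k => k.pc = 101 ∧ ConstRegs k.reg ∧ k.reg 0 = 1 ∧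
      EClosIn (k.reg 4) k.mem (k.reg 1) c ∧ StackIn (k.reg 4) k.mem (k.reg 3) S

theorem Ready.represents {s : State} {k : RAM.Config} (h : Ready s k) : Represents k s := by
  match s, h with
  | ⟨.nev t E, S⟩, h =>
    exact ⟨h.2.2.1, h.2.2.2.1.termAt, h.2.2.2.2.1.envAt, h.2.2.2.2.2.stackAt⟩
  | ⟨.ev c, S⟩, h => exact ⟨h.2.2.1, h.2.2.2.1.eClosAt, h.2.2.2.2.stackAt⟩

/-- After one instruction, `B` more steps lead to a configuration that satisfies `Q`. -/
abbrev Continues (B : ℕ) (k : RAM.Config) (Q : RAM.Config → Prop) : Prop :=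
  interpreter.Reaches B (interpreter.step k) Q

/-- A closure only points to the current environment, so it is built without copying. The contents
of its cells are given by equations, to be checked by `simp` in an updated memory. -/
theorem EClosIn.of_envIn {F : ℕ} {m : ℕ → ℕ} {a l e : ℕ} {xs : List ℕ} {t : Term} {E : Env}
    (lt : a + 2 < F) (tag : m a = 0) (hl : m (a + 1) = l) (he : m (a + 2) = e)
    (ht : TermIn F m l (.lam xs t)) (hE : EnvIn F m e E) : EClosIn F m a (.abs xs t E) := by
  subst hl he
  exact .abs a xs t E lt tag ht hE.1 hE.2.1
    (fun i x c hi => by rw [(hE.2.2 i x c hi).1])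
    (fun i x c hi => (hE.2.2 i x c hi).2)

-- Loop-free transitions on a non-evaluated m-closure

section NonEvaluated

variable {E : Env} {S : List Entry} {k : RAM.Config}

/-- The pattern for all loop-free transitions: execute the path symbolically, then transport the old
structures with `extend`. The number `60` is a common bound for all these paths. -/
theorem Ready.app {t u : Term} (h : Ready ⟨.nev (.app t u) E, S⟩ k) :
    Continues 60 k (Ready ⟨.nev u E, .clos (.nev t E) :: S⟩) := by
  obtain ⟨pc, r, m⟩ := k
  obtain ⟨rfl, ⟨h5, h6, h7, h8, h9, h10, h11⟩, h0, ht, hE, hS⟩ := h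
  simp only at *
  generalize h4 : r 4 = F at *
  generalize h1 : r 1 = a at *
  generalize h2 : r 2 = e at *
  generalize h3 : r 3 = s at *
  obtain _ | ⟨_, _, _, lt, tag, ht, hu⟩ := ht
  rw [Continues, step_eq rfl]
  simp [RAM.Instr.exec, h1, tag]
  -- The path has `17` instructions after the first: three of the tag dispatch and fourteen of the
  -- block for applications.
  iterate 17 refine Reaches.instr rfl ?_; simp [RAM.Instr.exec, *]
  refine Reaches.done ?_
  simp [Ready, ConstRegs, StackIn, *]
  refine ⟨hu.extend (by omega) ?_, hE.extend (by omega) ?_, hS.extend (by omega) ?_,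
    ht.extend (by omega) ?_, hE.extend (by omega) ?_⟩ <;>
    (intro i hi; simp (disch := omega) only [Function.update_of_ne])

theorem Ready.proj {i : ℕ} {t : Term} (h : Ready ⟨.nev (.proj i t) E, S⟩ k) :
    Continues 60 k (Ready ⟨.nev t E, .proj i :: S⟩) := by
  obtain ⟨pc, r, m⟩ := k
  obtain ⟨rfl, ⟨h5, h6, h7, h8, h9, h10, h11⟩, h0, ht, hE, hS⟩ := h
  simp only at *
  generalize h4 : r 4 = F at *
  generalize h1 : r 1 = a at *
  generalize h2 : r 2 = e at *
  generalize h3 : r 3 = s at *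
  obtain _ | _ | ⟨_, _, _, lt, tag, hi, ht⟩ := ht
  rw [Continues, step_eq rfl]
  simp [RAM.Instr.exec, h1, tag]
  iterate 17 refine Reaches.instr rfl ?_; simp [RAM.Instr.exec, *]
  refine Reaches.done ?_
  simp [Ready, ConstRegs, StackIn, *]
  refine ⟨ht.extend (by omega) ?_, hE.extend (by omega) ?_, hS.extend (by omega) ?_⟩ <;>
    (intro i hi; simp (disch := omega) only [Function.update_of_ne])

theorem Ready.lam {xs : List ℕ} {t : Term} (h : Ready ⟨.nev (.lam xs t) E, S⟩ k) :
    Continues 60 k (Ready ⟨.ev (.abs xs t E), S⟩) := by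
  obtain ⟨pc, r, m⟩ := k
  obtain ⟨rfl, ⟨h5, h6, h7, h8, h9, h10, h11⟩, h0, ht, hE, hS⟩ := h
  simp only at *
  generalize h4 : r 4 = F at *
  generalize h1 : r 1 = a at *
  generalize h2 : r 2 = e at *
  generalize h3 : r 3 = s at *
  have tag : m a = 3 := by cases ht; assumption
  rw [Continues, step_eq rfl]
  simp [RAM.Instr.exec, h1, tag]
  iterate 16 refine Reaches.instr rfl ?_; simp [RAM.Instr.exec, *]
  refine Reaches.done ?_
  simp [Ready, ConstRegs, *]
  refine ⟨.of_envIn (l := a) (e := e) (by omega) (by simp) (by simp) (by simp)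
    (ht.extend (by omega) ?_) (hE.extend (by omega) ?_), hS.extend (by omega) ?_⟩ <;>
    (intro i hi; simp (disch := omega) only [Function.update_of_ne])

theorem Ready.nil (h : Ready ⟨.nev (.tup []) E, S⟩ k) :
    Continues 60 k (Ready ⟨.ev (.tup []), S⟩) := by
  obtain ⟨pc, r, m⟩ := k
  obtain ⟨rfl, ⟨h5, h6, h7, h8, h9, h10, h11⟩, h0, ht, hE, hS⟩ := h
  simp only at *
  generalize h4 : r 4 = F at *
  generalize h1 : r 1 = a at *
  generalize h2 : r 2 = e at *
  generalize h3 : r 3 = s at *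
  obtain _ | _ | _ | _ | ⟨_, _, lt, tag, hlen, -⟩ := ht
  simp only [List.length_nil] at *
  rw [Continues, step_eq rfl]
  simp [RAM.Instr.exec, h1, tag]
  iterate 17 refine Reaches.instr rfl ?_; simp [RAM.Instr.exec, *]
  refine Reaches.done ?_
  simp [Ready, ConstRegs, *]
  refine ⟨.tup F [] (by simp) (by simp) (by simp) (by simp), hS.extend (by omega) ?_⟩
  intro i hi; simp (disch := omega) only [Function.update_of_ne]

/-- The array of remaining terms is the array inside the syntax node, cut by storing a smaller
length, so that nothing is copied. -/
theorem Ready.tup {ts : List Term} {t : Term} (h : Ready ⟨.nev (.tup (ts ++ [t])) E, S⟩ k) :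
    Continues 60 k (Ready ⟨.nev t E, .ptup ts [] E :: S⟩) := by
  obtain ⟨pc, r, m⟩ := k
  obtain ⟨rfl, ⟨h5, h6, h7, h8, h9, h10, h11⟩, h0, ht, hE, hS⟩ := h
  simp only at *
  generalize h4 : r 4 = F at *
  generalize h1 : r 1 = a at *
  generalize h2 : r 2 = e at *
  generalize h3 : r 3 = s at *
  obtain _ | _ | _ | _ | ⟨_, _, lt, tag, hlen, hts⟩ := ht
  simp only [List.length_append, List.length_singleton] at *
  have ht := hts ts.length t (by simp)
  rw [Continues, step_eq rfl]
  simp [RAM.Instr.exec, h1, tag]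
  iterate 30 refine Reaches.instr rfl ?_; simp [RAM.Instr.exec, *]
  refine Reaches.done ?_
  -- The cell `F + 5`, which holds the number `0` of computed components, doubles as their empty
  -- linked list.
  simp [Ready, ConstRegs, StackIn, EClosListIn, *]
  refine ⟨ht.extend (by omega) ?_, hE.extend (by omega) ?_, hS.extend (by omega) ?_,
    hE.extend (by omega) ?_, by omega, fun i t hi => ?_⟩
  pick_goal 5
  · have := (List.getElem?_eq_some_iff.1 hi).1
    simp (disch := omega) only [Function.update_of_ne]
    refine (hts i t (by rw [List.getElem?_append_left this, hi])).extend (by omega) ?_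
    intro i hi; simp (disch := omega) only [Function.update_of_ne]
  all_goals intro i hi; simp (disch := omega) only [Function.update_of_ne]

end NonEvaluated

-- Loop-free transitions on an evaluated m-closure

section Evaluated

variable {c : EClos} {E : Env} {S : List Entry} {k : RAM.Config}

theorem Ready.fetch {t : Term} (h : Ready ⟨.ev c, .clos (.nev t E) :: S⟩ k) :
    Continues 60 k (Ready ⟨.nev t E, .clos (.ev c) :: S⟩) := by
  obtain ⟨pc, r, m⟩ := k
  obtain ⟨rfl, ⟨h5, h6, h7, h8, h9, h10, h11⟩, h0, hc, hS⟩ := h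
  simp only at *
  generalize h4 : r 4 = F at *
  generalize h1 : r 1 = a at *
  generalize h3 : r 3 = s at *
  obtain ⟨lt, tag, hS, ht, hE⟩ := hS
  rw [Continues, step_eq rfl]
  simp [RAM.Instr.exec, h3, tag]
  iterate 21 refine Reaches.instr rfl ?_; simp [RAM.Instr.exec, *]
  refine Reaches.done ?_
  simp [Ready, ConstRegs, StackIn, *]
  refine ⟨ht.extend (by omega) ?_, hE.extend (by omega) ?_, hS.extend (by omega) ?_,
    hc.extend (by omega) ?_⟩ <;>
    (intro i hi; simp (disch := omega) only [Function.update_of_ne])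

/-- A fresh list cell and a fresh stack cell are allocated instead of modifying the old entry, which
may be shared; the array of terms is again reused with a smaller length. -/
theorem Ready.next {ts : List Term} {t : Term} {cs : List EClos}
    (h : Ready ⟨.ev c, .ptup (ts ++ [t]) cs E :: S⟩ k) :
    Continues 60 k (Ready ⟨.nev t E, .ptup ts (c :: cs) E :: S⟩) := by
  obtain ⟨pc, r, m⟩ := k
  obtain ⟨rfl, ⟨h5, h6, h7, h8, h9, h10, h11⟩, h0, hc, hS⟩ := h
  simp only at *
  generalize h4 : r 4 = F at *
  generalize h1 : r 1 = a at *
  generalize h3 : r 3 = s at *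
  obtain ⟨lt, tag, hS, hE, hlen, ltA, hts, hlen', hcs⟩ := hS
  simp only [List.length_append, List.length_singleton] at *
  have ht := hts ts.length t (by simp)
  rw [Continues, step_eq rfl]
  simp [RAM.Instr.exec, h3, tag]
  iterate 47 refine Reaches.instr rfl ?_; simp [RAM.Instr.exec, *]
  refine Reaches.done ?_
  simp [Ready, ConstRegs, StackIn, EClosListIn, *]
  refine ⟨ht.extend (by omega) ?_, hE.extend (by omega) ?_, hS.extend (by omega) ?_,
    hE.extend (by omega) ?_, by omega, fun i t hi => ?_, ?_, hcs.extend (by omega) ?_,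
    hc.extend (by omega) ?_⟩
  pick_goal 5
  · have := (List.getElem?_eq_some_iff.1 hi).1
    simp (disch := omega) only [Function.update_of_ne]
    refine (hts i t (by rw [List.getElem?_append_left this, hi])).extend (by omega) ?_
    intro i hi; simp (disch := omega) only [Function.update_of_ne]
  pick_goal 5
  · simp (disch := omega) only [Function.update_of_ne, Function.update_self]
  all_goals intro i hi; simp (disch := omega) only [Function.update_of_ne]

theorem Ready.pi {i : ℕ} {cs : List EClos} (hi : 1 ≤ i) (hc : cs[i - 1]? = some c)
    (h : Ready ⟨.ev (.tup cs), .proj i :: S⟩ k) :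
    Continues 60 k (Ready ⟨.ev c, S⟩) := by
  have hci := hc
  obtain ⟨pc, r, m⟩ := k
  obtain ⟨rfl, ⟨h5, h6, h7, h8, h9, h10, h11⟩, h0, hc, hS⟩ := h
  simp only at *
  generalize h4 : r 4 = F at *
  generalize h1 : r 1 = a at *
  generalize h3 : r 3 = s at *
  obtain ⟨lts, tag, hS, hsi⟩ := hS
  obtain _ | ⟨_, _, lt, tagc, hlen, hcs⟩ := hc
  have := (List.getElem?_eq_some_iff.1 hci).1
  have hc := hcs _ _ hci
  -- Projections count from `1` and array cells from `0`; the machine reads the cell `a + 1 + i`.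
  rw [show a + 2 + (i - 1) = a + 1 + i by omega] at hc
  have hi0 : i ≠ 0 := by omega
  have hlei : i ≤ cs.length := by omega
  rw [Continues, step_eq rfl]
  simp [RAM.Instr.exec, h3, tag]
  iterate 21 refine Reaches.instr rfl ?_; simp [RAM.Instr.exec, *]
  refine Reaches.done ?_
  simp [Ready, ConstRegs, *]

end Evaluated

-- The four loops of the interpreter

section Loops

/-- The loop that searches an environment. -/
theorem reaches_lookup {x : ℕ} : ∀ {E : Env} {r : ℕ → ℕ} {p : ℕ}, ConstRegs r → r 12 = x →
    r 13 = E.length → r 14 = p →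
    (∀ (i y : ℕ) (c : EClos), E[i]? = some (y, c) → m (p + 2 * i) = y) →
    interpreter.Reaches (9 * E.length + 1) ⟨89, r, m⟩ fun k =>
      k.mem = m ∧ (∀ j < 12, k.reg j = r j) ∧ (E.lookup x = none ∧ k.pc = 205 ∨
        ∃ i y c, E.lookup x = some c ∧ E[i]? = some (y, c) ∧ k.pc = 98 ∧
          k.reg 14 = p + 2 * i) := by
  intro E
  induction E with
  | nil =>
    intro r p ⟨h5, h6, h7, h8, h9, h10, h11⟩ h12 h13 h14 hE
    refine Reaches.instr rfl ?_; simp [RAM.Instr.exec, *]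
    refine Reaches.done ?_
    simp [Env.lookup]
  | cons e E ih =>
    obtain ⟨y, c⟩ := e
    intro r p hr h12 h13 h14 hE
    obtain ⟨h5, h6, h7, h8, h9, h10, h11⟩ := id hr
    have hy := hE 0 y c rfl
    simp only [List.length_cons, Nat.mul_zero, Nat.add_zero] at *
    refine (?_ : Program.Reaches _ (9 * E.length + 10) _ _).mono (by omega)
    iterate 5 refine Reaches.instr rfl ?_; simp [RAM.Instr.exec, *]
    by_cases hxy : y = x
    · subst hxy
      refine Reaches.instr rfl ?_; simp [RAM.Instr.exec, *]
      refine Reaches.done ⟨rfl, fun j hj => ?_, .inr ⟨0, y, c, by simp [Env.lookup], rfl, rfl, ?_⟩⟩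
      · simp (disch := omega) only [Function.update_of_ne]
      · simpa using h14
    -- The machine tests equality by adding the two truncated differences.
    · have hne : ¬ (y - x = 0 ∧ x - y = 0) := by omega
      refine Reaches.instr rfl ?_; simp only [RAM.Instr.exec]
      rw [if_neg (by simpa using hne)]
      iterate 3 refine Reaches.instr rfl ?_; simp [RAM.Instr.exec, *]
      refine (Reaches.mono ((ih (p := p + 2) (hr.congr ?_) ?_ ?_ ?_ ?_).bind (B' := 0) ?_) le_rfl)
      · intro j hj
        simp (disch := omega) only [Function.update_of_ne]
      · simp [h12]
      · simp
      · simp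
      · intro i y c hi
        rw [← hE (i + 1) y c (by simpa using hi)]
        congr 1
        ring
      · intro d ⟨hd1, hd2, hd3⟩
        refine Reaches.done ⟨hd1, fun j hj => ?_, ?_⟩
        · rw [hd2 j hj]
          simp (disch := omega) only [Function.update_of_ne]
        · rcases hd3 with ⟨h, h'⟩ | ⟨i, y, c, h, h', h'', h'''⟩
          · exact .inl ⟨by simp [Env.lookup, hxy, h], h'⟩
          · exact .inr ⟨i + 1, y, c, by simp [Env.lookup, hxy, h], by simpa using h', h'',
              by rw [h''']; ring⟩

/-- The loop that copies a list of m-closures into an array. -/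
theorem reaches_build {F : ℕ} : ∀ {cs : List EClos} {r m : ℕ → ℕ} {q d : ℕ}, ConstRegs r →
    r 4 = d → r 13 = cs.length → r 14 = q → F ≤ d → EClosListIn F m q cs →
    interpreter.Reaches (9 * cs.length + 1) ⟨163, r, m⟩ fun k =>
      k.pc = 101 ∧ (∀ j < 12, j ≠ 4 → k.reg j = r j) ∧ k.reg 4 = d + cs.length ∧
      (∀ i < d, k.mem i = m i) ∧
      ∀ (i : ℕ) (c : EClos), cs[i]? = some c → EClosIn F k.mem (k.mem (d + i)) c := by
  intro cs
  induction cs with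
  | nil =>
    intro r m q d ⟨h5, h6, h7, h8, h9, h10, h11⟩ h4 h13 h14 hF hcs
    refine Reaches.instr rfl ?_; simp [RAM.Instr.exec, *]
    refine Reaches.done ?_
    simp [*]
  | cons c cs ih =>
    intro r m q d hr h4 h13 h14 hF ⟨lt, tag, hcs, hc⟩
    obtain ⟨h5, h6, h7, h8, h9, h10, h11⟩ := id hr
    simp only [List.length_cons] at *
    refine (?_ : Program.Reaches _ (9 * cs.length + 10) _ _).mono (by omega)
    -- The loop writes only at `d ≥ F`, so the list that it traverses and the m-closures in it stay
    -- intact.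
    have hm : ∀ i < d, Function.update m d (m (q + 2)) i = m i := fun i hi =>
      Function.update_of_ne (by omega) _ _
    have hq := hm (q + 1) (by omega)
    iterate 9 refine Reaches.instr rfl ?_; simp [RAM.Instr.exec, *]
    refine (Reaches.mono ((ih (d := d + 1) (q := m (q + 1)) ⟨?_, ?_, ?_, ?_, ?_, ?_, ?_⟩ ?_ ?_ ?_
      (by omega) (hcs.extend le_rfl fun i hi => hm i (by omega))).bind (B' := 0) ?_) le_rfl)
    pick_goal 11
    · intro k ⟨k1, k2, k3, k4, k5⟩
      refine Reaches.done ⟨k1, fun j hj hj' => ?_, by omega, fun i hi => ?_, fun i c' hi => ?_⟩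
      · rw [k2 j hj hj']
        simp (disch := omega) only [Function.update_of_ne]
      · rw [k4 i (by omega), hm i hi]
      · rcases i with _ | i
        · obtain rfl : c = c' := by simpa using hi
          rw [Nat.add_zero, k4 d (by omega), Function.update_self]
          exact hc.extend le_rfl fun i hi => by rw [k4 i (by omega), hm i (by omega)]
        · have := k5 i c' (by simpa using hi)
          rwa [show d + (i + 1) = d + 1 + i by ring]
    all_goals simp [*]

/-- The loop that interleaves two arrays. -/
theorem reaches_zip : ∀ {n : ℕ} {r m : ℕ → ℕ} {p q d : ℕ}, ConstRegs r →
    r 4 = d → r 13 = q → r 14 = p → r 15 = n → p + n ≤ d → q + n ≤ d →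
    interpreter.Reaches (11 * n + 1) ⟨234, r, m⟩ fun k =>
      k.pc = 245 ∧ (∀ j, j ≠ 4 → j < 12 ∨ 15 < j → k.reg j = r j) ∧ k.reg 4 = d + 2 * n ∧
      (∀ i < d, k.mem i = m i) ∧
      ∀ i < n, k.mem (d + 2 * i) = m (p + i) ∧ k.mem (d + 2 * i + 1) = m (q + i) := by
  intro n
  induction n with
  | zero =>
    intro r m p q d ⟨h5, h6, h7, h8, h9, h10, h11⟩ h4 h13 h14 h15 hp hq
    refine Reaches.instr rfl ?_; simp [RAM.Instr.exec, *]
    refine Reaches.done ?_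
    simp [*]
  | succ n ih =>
    intro r m p q d hr h4 h13 h14 h15 hp hq
    obtain ⟨h5, h6, h7, h8, h9, h10, h11⟩ := id hr
    refine (?_ : Program.Reaches _ (11 * n + 12) _ _).mono (by omega)
    -- Both source arrays end at or before `d`, so writing the destination does not disturb them.
    have hm : ∀ i < d, Function.update (Function.update m d (m p)) (d + 1) (m q) i = m i :=
      fun i hi => by simp (disch := omega) only [Function.update_of_ne]
    have hq' : Function.update m d (m p) q = m q := Function.update_of_ne (by omega) _ _
    iterate 11 refine Reaches.instr rfl ?_; simp [RAM.Instr.exec, *]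
    refine (Reaches.mono ((ih (d := d + 2) (p := p + 1) (q := q + 1) ⟨?_, ?_, ?_, ?_, ?_, ?_, ?_⟩
      ?_ ?_ ?_ ?_ (by omega) (by omega)).bind (B' := 0) ?_) le_rfl)
    pick_goal 12
    · intro k ⟨k1, k2, k3, k4, k5⟩
      refine Reaches.done ⟨k1, fun j hj hj' => ?_, by omega, fun i hi => ?_, fun i hi => ?_⟩
      · rw [k2 j hj hj']
        simp (disch := omega) only [Function.update_of_ne]
      · rw [k4 i (by omega), hm i hi]
      · rcases i with _ | i
        · rw [Nat.mul_zero, Nat.add_zero, k4 d (by omega), k4 (d + 1) (by omega)]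
          simp
        · have := k5 i (by omega)
          rw [hm _ (by omega), hm _ (by omega)] at this
          rwa [show d + 2 * (i + 1) = d + 2 + 2 * i by ring, show p + (i + 1) = p + 1 + i by ring,
            show q + (i + 1) = q + 1 + i by ring]
    all_goals simp [*]

/-- The loop that copies an array. -/
theorem reaches_copy : ∀ {n : ℕ} {r m : ℕ → ℕ} {p d : ℕ}, ConstRegs r →
    r 4 = d → r 17 = p → r 18 = n → p + n ≤ d →
    interpreter.Reaches (7 * n + 1) ⟨247, r, m⟩ fun k =>
      k.pc = 254 ∧ (∀ j < 12, j ≠ 4 → k.reg j = r j) ∧ k.reg 4 = d + n ∧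
      (∀ i < d, k.mem i = m i) ∧ ∀ i < n, k.mem (d + i) = m (p + i) := by
  intro n
  induction n with
  | zero =>
    intro r m p d ⟨h5, h6, h7, h8, h9, h10, h11⟩ h4 h17 h18 hp
    refine Reaches.instr rfl ?_; simp [RAM.Instr.exec, *]
    refine Reaches.done ?_
    simp [*]
  | succ n ih =>
    intro r m p d hr h4 h17 h18 hp
    obtain ⟨h5, h6, h7, h8, h9, h10, h11⟩ := id hr
    refine (?_ : Program.Reaches _ (7 * n + 8) _ _).mono (by omega)
    have hm : ∀ i < d, Function.update m d (m p) i = m i :=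
      fun i hi => by simp (disch := omega) only [Function.update_of_ne]
    iterate 7 refine Reaches.instr rfl ?_; simp [RAM.Instr.exec, *]
    refine (Reaches.mono ((ih (d := d + 1) (p := p + 1) ⟨?_, ?_, ?_, ?_, ?_, ?_, ?_⟩
      ?_ ?_ ?_ (by omega)).bind (B' := 0) ?_) le_rfl)
    pick_goal 11
    · intro k ⟨k1, k2, k3, k4, k5⟩
      refine Reaches.done ⟨k1, fun j hj hj' => ?_, by omega, fun i hi => ?_, fun i hi => ?_⟩
      · rw [k2 j hj hj']
        simp (disch := omega) only [Function.update_of_ne]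
      · rw [k4 i (by omega), hm i hi]
      · rcases i with _ | i
        · rw [Nat.add_zero, k4 d (by omega)]
          simp
        · have := k5 i (by omega)
          rw [hm _ (by omega)] at this
          rwa [show d + (i + 1) = d + 1 + i by ring, show p + (i + 1) = p + 1 + i by ring]
    all_goals simp [*]

end Loops

-- Transitions that run a loop

section Searches

variable {c : EClos} {E : Env} {S : List Entry} {k : RAM.Config}

/-- Serves both bound and unbound variables: the search changes neither the memory nor the registers
below `12`, so after a failure the state is still represented. -/
theorem Ready.search {x : ℕ} (h : Ready ⟨.nev (.var x) E, S⟩ k) :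
    Continues (9 * E.length + 10) k fun k' =>
      k'.mem = k.mem ∧ (∀ j < 12, k'.reg j = k.reg j) ∧ (E.lookup x = none ∧ k'.pc = 205 ∨
        ∃ i y c, E.lookup x = some c ∧ E[i]? = some (y, c) ∧ k'.pc = 98 ∧
          k'.reg 14 = k.reg 2 + 1 + 2 * i) := by
  obtain ⟨pc, r, m⟩ := k
  obtain ⟨rfl, ⟨h5, h6, h7, h8, h9, h10, h11⟩, h0, ht, hE, hS⟩ := h
  simp only at *
  generalize h4 : r 4 = F at *
  generalize h1 : r 1 = a at *
  generalize h2 : r 2 = e at *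
  generalize h3 : r 3 = s at *
  have hx : m a = 0 ∧ m (a + 1) = x := by cases ht; exact ⟨‹_›, ‹_›⟩
  obtain ⟨tag, hx⟩ := hx
  obtain ⟨ltE, hlen, hE⟩ := hE
  rw [Continues, step_eq rfl]
  simp [RAM.Instr.exec, h1, tag]
  iterate 5 refine Reaches.instr rfl ?_; simp [RAM.Instr.exec, *]
  refine (((reaches_lookup (x := x) (E := E) (p := e + 1) (ConstRegs.congr (r := r) ?_ ?_)
    ?_ ?_ ?_ fun i y c hi => (hE i y c hi).1).bind (B' := 0) ?_).mono (by omega))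
  pick_goal 6
  · intro d ⟨d1, d2, d3⟩
    refine Reaches.done ⟨d1, fun j hj => ?_, d3⟩
    rw [d2 j hj]
    simp (disch := omega) only [Function.update_of_ne]
  pick_goal 2
  · intro j hj
    simp (disch := omega) only [Function.update_of_ne]
  all_goals simp [ConstRegs, *]

theorem Ready.sub {x : ℕ} (hx : E.lookup x = some c) (h : Ready ⟨.nev (.var x) E, S⟩ k) :
    Continues (14 * E.length + 100) k (Ready ⟨.ev c, S⟩) := by
  refine ((h.search.bind (B' := 10) ?_).mono (by omega))
  intro k' ⟨k1, k2, k3⟩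
  rcases k3 with ⟨k3, -⟩ | ⟨i, y, c', hc', hi, k3, k4⟩
  · simp [hx] at k3
  obtain rfl : c = c' := by simpa [hx] using hc'
  obtain ⟨pc, r, m⟩ := k
  obtain ⟨rfl, ⟨h5, h6, h7, h8, h9, h10, h11⟩, h0, ht, hE, hS⟩ := h
  simp only at *
  generalize h4 : r 4 = F at *
  generalize h1 : r 1 = a at *
  generalize h2 : r 2 = e at *
  generalize h3 : r 3 = s at *
  obtain ⟨pc', r', m'⟩ := k'
  simp only at *
  subst k1 k3
  have hc := (hE.2.2 i y c hi).2
  obtain ⟨k5, k6, k7, k8, k9, k10, k11⟩ : ConstRegs r' :=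
    ConstRegs.congr (r := r) ⟨h5, h6, h7, h8, h9, h10, h11⟩ k2
  have k2' := k2 4 (by omega)
  have k2'' := k2 3 (by omega)
  iterate 3 refine Reaches.instr rfl ?_; simp [RAM.Instr.exec, *]
  refine Reaches.done ?_
  simp [Ready, ConstRegs, *]
  rwa [show e + 1 + 2 * i + 1 = e + 2 + 2 * i by ring]

/-- The one transition whose cost is not controlled by the height; the potential stored in the stack
entry will pay for it. -/
theorem Ready.build {cs : List EClos} (h : Ready ⟨.ev c, .ptup [] cs E :: S⟩ k) :
    Continues (14 * cs.length + 100) k (Ready ⟨.ev (.tup (c :: cs)), S⟩) := by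
  obtain ⟨pc, r, m⟩ := k
  obtain ⟨rfl, ⟨h5, h6, h7, h8, h9, h10, h11⟩, h0, hc, hS⟩ := h
  simp only at *
  generalize h4 : r 4 = F at *
  generalize h1 : r 1 = a at *
  generalize h3 : r 3 = s at *
  obtain ⟨lt, tag, hS, hE, hlen, ltA, hts, hlen', hcs⟩ := hS
  simp only [List.length_nil] at *
  rw [Continues, step_eq rfl]
  simp [RAM.Instr.exec, h3, tag]
  iterate 24 refine Reaches.instr rfl ?_; simp [RAM.Instr.exec, *]
  generalize hm' : Function.update (Function.update (Function.update m F 1) (F + 1)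
    (cs.length + 1)) (F + 2) a = m'
  have hm : ∀ i < F, m' i = m i := fun i hi => by
    subst hm'
    simp (disch := omega) only [Function.update_of_ne]
  refine (((reaches_build (cs := cs) (F := F) (d := F + 3) (q := m (s + 6)) ?_ ?_ ?_ ?_ (by omega)
    (hcs.extend le_rfl hm)).bind (B' := 0) ?_).mono (by omega))
  pick_goal 5
  · intro k ⟨k1, k2, k3, k4, k5⟩
    have k2 : ∀ j < 12, j ≠ 1 → j ≠ 3 → j ≠ 4 → k.reg j = r j := fun j hj h1 h3 h4 => by
      rw [k2 j hj h4]
      simp (disch := omega) only [Function.update_of_ne]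
    have k21 : k.reg 1 = F := by simp [*]
    have k23 : k.reg 3 = m (s + 1) := by simp [*]
    have k4' : ∀ i < F, k.mem i = m i := fun i hi => by rw [k4 i (by omega), hm i hi]
    refine Reaches.done ⟨k1, ?_, by simp [*], ?_, ?_⟩
    · simp [ConstRegs, *]
    · rw [k21, k3]
      refine .tup F _ (by simp; omega) ?_ ?_ fun i c' hi => ?_
      · rw [k4 _ (by omega), ← hm']
        simp (disch := omega) only [Function.update_of_ne, Function.update_self]
      · rw [k4 _ (by omega), ← hm', List.length_cons]
        simp (disch := omega) only [Function.update_of_ne, Function.update_self]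
      -- The component `c` was written at `F + 2` before the loop; the loop fills the cells from `F
      -- + 3` on.
      · rcases i with _ | i
        · obtain rfl : c = c' := by simpa using hi
          rw [Nat.add_zero, k4 _ (by omega), ← hm', Function.update_self]
          exact hc.extend (by omega) k4'
        · have := k5 i c' (by simpa using hi)
          rw [show F + 2 + (i + 1) = F + 3 + i by ring]
          exact this.extend (by omega) fun _ _ => rfl
    · rw [k23, k3]
      exact hS.extend (by omega) k4'
  all_goals simp [ConstRegs, *]

/-- The new environment is a fresh array: variables and arguments are interleaved, then the old
environment is copied. Copying takes `7` instructions per cell and an entry has two cells, whence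
the factor `14`. -/
theorem Ready.beta {xs : List ℕ} {t : Term} {cs : List EClos} (hlen : xs.length = cs.length)
    (h : Ready ⟨.ev (.abs xs t E), .clos (.ev (.tup cs)) :: S⟩ k) :
    Continues (14 * (xs.length + E.length) + 100) k (Ready ⟨.nev t (xs.zip cs ++ E), S⟩) := by
  obtain ⟨pc, r, m⟩ := k
  obtain ⟨rfl, ⟨h5, h6, h7, h8, h9, h10, h11⟩, h0, hc, hS⟩ := h
  simp only at *
  generalize h4 : r 4 = F at *
  generalize h1 : r 1 = a at *
  generalize h3 : r 3 = s at *
  obtain ⟨lt, tag, hS, hcs⟩ := hS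
  obtain ⟨_, _, _, _, lta, taga, ht, ltE, hE, hvar, hclos⟩ | _ := hc
  generalize hl : m (a + 1) = l at *
  generalize he : m (a + 2) = e at *
  generalize hb : m (s + 2) = b at *
  obtain _ | _ | _ | ⟨_, _, _, ltl, tagl, hll, ht, hxs⟩ := ht
  obtain _ | ⟨_, _, ltb, tagb, hlb, hcs⟩ := hcs
  rw [Continues, step_eq rfl]
  simp [RAM.Instr.exec, h3, tag]
  iterate 32 refine Reaches.instr rfl ?_; simp [RAM.Instr.exec, *]
  generalize hm' : Function.update m F (cs.length + E.length) = m'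
  have hm : ∀ i < F, m' i = m i := fun i hi => by
    subst hm'
    simp (disch := omega) only [Function.update_of_ne]
  refine (((reaches_zip (n := xs.length) (d := F + 1) (p := l + 3) (q := b + 2) ?_ ?_ ?_ ?_ ?_
    -- The `5` counts two instructions that set up the copying loop, its exit test, and the two that
    -- return to the dispatch.
    (by omega) (by omega)).bind (B' := 14 * E.length + 5) ?_).mono (by omega))
  pick_goal 6
  · intro ⟨pc₁, r₁, m₁⟩ ⟨k1, k2, k3, k4, k5⟩
    simp only at *
    subst k1
    have k2' : ∀ j < 12, j ≠ 1 → j ≠ 2 → j ≠ 3 → j ≠ 4 → r₁ j = r j :=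
      fun j hj h1 h2 h3 h4 => by
        rw [k2 j h4 (.inl hj)]
        simp (disch := omega) only [Function.update_of_ne]
    have k21 : r₁ 1 = m (l + 2) := by simp [*]
    have k22 : r₁ 2 = F := by simp [*]
    have k23 : r₁ 3 = m (s + 1) := by simp [*]
    -- Registers `17` and `18`, kept by the interleaving loop, carry the address and length of the
    -- old environment to the copying loop.
    have k217 : r₁ 17 = e := by simp [*]
    have k218 : r₁ 18 = E.length := by simp [*]
    have k26 : r₁ 6 = 1 := by simp [*]
    clear k2
    iterate 2 refine Reaches.instr rfl ?_; simp [RAM.Instr.exec, k217, k218, k26]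
    refine (((reaches_copy (n := E.length + E.length) (d := F + 1 + 2 * xs.length) (p := e + 1)
      ?_ ?_ ?_ ?_ (by omega)).bind (B' := 2) ?_).mono (by omega))
    pick_goal 5
    · intro ⟨pc₂, r₂, m₂⟩ ⟨l1, l2, l3, l4, l5⟩
      simp only at *
      subst l1
      have l2' : ∀ j < 12, j ≠ 4 → r₂ j = r₁ j := fun j hj h4 => by
        rw [l2 j hj h4]
        simp (disch := omega) only [Function.update_of_ne]
      have l25 : r₂ 5 = 0 := by simp [*]
      clear l2
      iterate 2 refine Reaches.instr rfl ?_; simp [RAM.Instr.exec, l25]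
      have l4' : ∀ i < F, m₂ i = m i := fun i hi => by
        rw [l4 i (by omega), k4 i (by omega), hm i hi]
      refine Reaches.done ⟨rfl, ?_, by simp, ?_, ?_, ?_⟩
      · simp [ConstRegs, *]
      · simpa [l2', l3, k21] using ht.extend (by omega) l4'
      · have hlz : (xs.zip cs).length = xs.length := by simp [hlen]
        have h2 : (Function.update r₂ 0 0) 2 = F := by simp [l2', k22]
        have h4 : (Function.update r₂ 0 0) 4 = F + 1 + 2 * xs.length + (E.length + E.length) := by
          simpa using l3
        simp only [h2, h4]
        refine ⟨by rw [List.length_append, hlz]; omega, ?_, fun i x c hi => ?_⟩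
        · rw [l4 _ (by omega), k4 _ (by omega), ← hm', Function.update_self, List.length_append,
            hlz, hlen]
        · have hiL := (List.getElem?_eq_some_iff.1 hi).1
          rw [List.length_append, hlz] at hiL
          -- Entries below `xs.length` come from the interleaving loop, the others from the copy.
          rcases lt_or_ge i xs.length with hlt | hge
          · rw [List.getElem?_append_left (by omega), List.getElem?_zip_eq_some] at hi
            obtain ⟨kx, kc⟩ := k5 i hlt
            rw [l4 _ (by omega), l4 _ (by omega), kx, show F + 2 + 2 * i = F + 1 + 2 * i + 1 by ring,
              kc, hm _ (by omega), hm _ (by omega)]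
            exact ⟨hxs i x hi.1, (hcs i c hi.2).extend (by omega) l4'⟩
          · rw [List.getElem?_append_right (by omega), hlz] at hi
            obtain ⟨i, rfl⟩ := Nat.exists_eq_add_of_le hge
            rw [Nat.add_sub_cancel_left] at hi
            have e1 := l5 (2 * i) (by omega)
            have e2 := l5 (2 * i + 1) (by omega)
            rw [k4 _ (by omega), hm _ (by omega)] at e1 e2
            rw [show F + 1 + 2 * (xs.length + i) = F + 1 + 2 * xs.length + 2 * i by ring,
              show F + 2 + 2 * (xs.length + i) = F + 1 + 2 * xs.length + (2 * i + 1) by ring, e1, e2,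
              show e + 1 + (2 * i + 1) = e + 2 + 2 * i by ring]
            exact ⟨hvar i x c hi, (hclos i x c hi).extend (by omega) l4'⟩
      · simpa [l2', l3, k23] using hS.extend (by omega) l4'
    all_goals simp [ConstRegs, *]
  all_goals simp [ConstRegs, *]

end Searches

-- Final states and the initial configuration

section Halting

variable {c : EClos} {E : Env} {S : List Entry} {s : State} {k : RAM.Config}

/-- The interpreter has stopped, and still represents the state that `k` represents. -/
def StoppedFrom (k k' : RAM.Config) : Prop :=
  k'.pc = 205 ∧ k'.mem = k.mem ∧ ∀ j < 12, k'.reg j = k.reg j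

theorem StoppedFrom.halted {k' : RAM.Config} (h : StoppedFrom k k') : interpreter.Halted k' := by
  right
  rw [h.1]
  rfl

theorem StoppedFrom.represents {k' : RAM.Config} (h : StoppedFrom k k') (hk : Represents k s) :
    Represents k' s := by
  obtain ⟨-, hm, hr⟩ := h
  match s, hk with
  | ⟨.nev t E, S⟩, hk => simpa [Represents, hm, hr] using hk
  | ⟨.ev c, S⟩, hk => simpa [Represents, hm, hr] using hk

theorem Ready.stops_unbound {x : ℕ} (hx : E.lookup x = none) (h : Ready ⟨.nev (.var x) E, S⟩ k) :
    Continues (14 * E.length + 100) k (StoppedFrom k) := by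
  refine ((h.search.bind (B' := 0) ?_).mono (by omega))
  intro k' ⟨k1, k2, k3⟩
  rcases k3 with ⟨-, k3⟩ | ⟨i, y, c', hc', -⟩
  · exact Reaches.done ⟨k3, k1, k2⟩
  · simp [hx] at hc'

theorem Ready.stops_empty (h : Ready ⟨.ev c, []⟩ k) : Continues 100 k (StoppedFrom k) := by
  obtain ⟨pc, r, m⟩ := k
  obtain ⟨rfl, ⟨h5, h6, h7, h8, h9, h10, h11⟩, h0, hc, hS⟩ := h
  simp only at *
  generalize h4 : r 4 = F at *
  generalize h1 : r 1 = a at *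
  generalize h3 : r 3 = s at *
  obtain ⟨lt, tag⟩ := hS
  rw [Continues, step_eq rfl]
  simp [RAM.Instr.exec, h3, tag]
  iterate 1 refine Reaches.instr rfl ?_; simp [RAM.Instr.exec, *]
  refine Reaches.done ⟨rfl, rfl, fun j hj => ?_⟩
  simp (disch := omega) only [Function.update_of_ne]

theorem Ready.stops_tup {cs : List EClos} (h : Ready ⟨.ev (.tup cs), .clos (.ev c) :: S⟩ k) :
    Continues 100 k (StoppedFrom k) := by
  obtain ⟨pc, r, m⟩ := k
  obtain ⟨rfl, ⟨h5, h6, h7, h8, h9, h10, h11⟩, h0, hc, hS⟩ := h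
  simp only at *
  generalize h4 : r 4 = F at *
  generalize h1 : r 1 = a at *
  generalize h3 : r 3 = s at *
  obtain ⟨lt, tag, hS, hc'⟩ := hS
  have taga : m a = 1 := by cases hc; assumption
  rw [Continues, step_eq rfl]
  simp [RAM.Instr.exec, h3, tag]
  iterate 5 refine Reaches.instr rfl ?_; simp [RAM.Instr.exec, *]
  refine Reaches.done ⟨rfl, rfl, fun j hj => ?_⟩
  simp (disch := omega) only [Function.update_of_ne]

theorem Ready.stops_abs {xs ys : List ℕ} {t u : Term} {E' : Env}
    (h : Ready ⟨.ev (.abs xs t E), .clos (.ev (.abs ys u E')) :: S⟩ k) :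
    Continues 100 k (StoppedFrom k) := by
  obtain ⟨pc, r, m⟩ := k
  obtain ⟨rfl, ⟨h5, h6, h7, h8, h9, h10, h11⟩, h0, hc, hS⟩ := h
  simp only at *
  generalize h4 : r 4 = F at *
  generalize h1 : r 1 = a at *
  generalize h3 : r 3 = s at *
  obtain ⟨lt, tag, hS, hc'⟩ := hS
  have taga : m a = 0 := by cases hc; assumption
  have tagb : m (m (s + 2)) = 0 := by cases hc'; assumption
  rw [Continues, step_eq rfl]
  simp [RAM.Instr.exec, h3, tag]
  iterate 9 refine Reaches.instr rfl ?_; simp [RAM.Instr.exec, *]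
  refine Reaches.done ⟨rfl, rfl, fun j hj => ?_⟩
  simp (disch := omega) only [Function.update_of_ne]

theorem Ready.stops_arity {xs : List ℕ} {t : Term} {cs : List EClos} (hn : xs.length ≠ cs.length)
    (h : Ready ⟨.ev (.abs xs t E), .clos (.ev (.tup cs)) :: S⟩ k) :
    Continues 100 k (StoppedFrom k) := by
  obtain ⟨pc, r, m⟩ := k
  obtain ⟨rfl, ⟨h5, h6, h7, h8, h9, h10, h11⟩, h0, hc, hS⟩ := h
  simp only at *
  generalize h4 : r 4 = F at *
  generalize h1 : r 1 = a at *
  generalize h3 : r 3 = s at *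
  obtain ⟨lt, tag, hS, hcs⟩ := hS
  obtain ⟨_, _, _, _, lta, taga, ht, -⟩ | _ := hc
  have hll : m (m (a + 1) + 1) = xs.length := by cases ht; assumption
  obtain _ | ⟨_, _, ltb, tagb, hlb, hcs⟩ := hcs
  have hne : ¬ (cs.length - xs.length = 0 ∧ xs.length - cs.length = 0) := by omega
  rw [Continues, step_eq rfl]
  simp [RAM.Instr.exec, h3, tag]
  iterate 20 refine Reaches.instr rfl ?_; simp [RAM.Instr.exec, *]
  refine Reaches.done ⟨rfl, rfl, fun j hj => ?_⟩
  simp (disch := omega) only [Function.update_of_ne]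

theorem Ready.stops_proj_abs {xs : List ℕ} {t : Term} {i : ℕ}
    (h : Ready ⟨.ev (.abs xs t E), .proj i :: S⟩ k) : Continues 100 k (StoppedFrom k) := by
  obtain ⟨pc, r, m⟩ := k
  obtain ⟨rfl, ⟨h5, h6, h7, h8, h9, h10, h11⟩, h0, hc, hS⟩ := h
  simp only at *
  generalize h4 : r 4 = F at *
  generalize h1 : r 1 = a at *
  generalize h3 : r 3 = s at *
  obtain ⟨lt, tag, hS, hi⟩ := hS
  have taga : m a = 0 := by cases hc; assumption
  rw [Continues, step_eq rfl]
  simp [RAM.Instr.exec, h3, tag]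
  iterate 9 refine Reaches.instr rfl ?_; simp [RAM.Instr.exec, *]
  refine Reaches.done ⟨rfl, rfl, fun j hj => ?_⟩
  simp (disch := omega) only [Function.update_of_ne]

theorem Ready.stops_proj {cs : List EClos} {i : ℕ} (hi : i = 0 ∨ cs.length < i)
    (h : Ready ⟨.ev (.tup cs), .proj i :: S⟩ k) : Continues 100 k (StoppedFrom k) := by
  obtain ⟨pc, r, m⟩ := k
  obtain ⟨rfl, ⟨h5, h6, h7, h8, h9, h10, h11⟩, h0, hc, hS⟩ := h
  simp only at *
  generalize h4 : r 4 = F at *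
  generalize h1 : r 1 = a at *
  generalize h3 : r 3 = s at *
  obtain ⟨lt, tag, hS, hsi⟩ := hS
  obtain _ | ⟨_, _, lta, taga, hlen, -⟩ := hc
  rw [Continues, step_eq rfl]
  simp [RAM.Instr.exec, h3, tag]
  iterate 11 refine Reaches.instr rfl ?_; simp [RAM.Instr.exec, *]
  by_cases hi0 : i = 0
  · subst hi0
    iterate 1 refine Reaches.instr rfl ?_; simp [RAM.Instr.exec, *]
    refine Reaches.done ⟨rfl, rfl, fun j hj => ?_⟩
    simp (disch := omega) only [Function.update_of_ne]
  · have hlt : i - cs.length ≠ 0 := by omega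
    iterate 6 refine Reaches.instr rfl ?_; simp [RAM.Instr.exec, *]
    refine Reaches.done ⟨rfl, rfl, fun j hj => ?_⟩
    simp (disch := omega) only [Function.update_of_ne]

/-- Finality leaves only an unbound variable, an empty stack, or a mismatch between the active
m-closure and the top of the stack. The value of `B` is exposed because the invariant must later
bound the length of `E`. -/
theorem Ready.stops (hs : s.Final) (h : Ready s k) :
    ∃ B, (∀ t E S, s = ⟨.nev t E, S⟩ → B = 14 * E.length + 100) ∧
      (∀ c S, s = ⟨.ev c, S⟩ → B = 100) ∧ Continues B k (StoppedFrom k) := by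
  match s, h with
  | ⟨.nev (.var x) E, S⟩, h =>
    refine ⟨14 * E.length + 100, by rintro _ _ _ ⟨⟩; rfl, by rintro _ _ ⟨⟩, ?_⟩
    cases hx : E.lookup x with
    | none => exact h.stops_unbound hx
    | some c => exact absurd (.oSub x c E S hx) (hs _ _)
  | ⟨.nev (.app t u) E, S⟩, h => exact absurd (.oSea1 t u E S) (hs _ _)
  | ⟨.nev (.proj i t) E, S⟩, h => exact absurd (.oSea2 i t E S) (hs _ _)
  | ⟨.nev (.lam xs t) E, S⟩, h => exact absurd (.oSea5 xs t E S) (hs _ _)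
  | ⟨.nev (.tup ts) E, S⟩, h =>
    rcases ts.eq_nil_or_concat with rfl | ⟨ts, t, rfl⟩
    · exact absurd (.oSea4 E S) (hs _ _)
    · exact absurd (.oSea3 _ ts t E S (by simp)) (hs _ _)
  | ⟨.ev c, S⟩, h =>
    refine ⟨100, by rintro _ _ _ ⟨⟩, fun _ _ _ => rfl, ?_⟩
    match c, S, h with
    | c, [], h => exact h.stops_empty
    | c, .clos (.nev t E) :: S, h => exact absurd (.eSea1 c t E S) (hs _ _)
    | .tup cs, .clos (.ev c) :: S, h => exact h.stops_tup
    | .abs xs t E, .clos (.ev (.abs ys u E')) :: S, h => exact h.stops_abs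
    | .abs xs t E, .clos (.ev (.tup cs)) :: S, h =>
      exact h.stops_arity fun hn => hs _ _ (.beta xs t E cs S hn)
    | .abs xs t E, .proj i :: S, h => exact h.stops_proj_abs
    | .tup cs, .proj i :: S, h =>
      refine h.stops_proj ?_
      by_contra! hi
      exact hs _ _ (.pi i cs cs[i - 1] S (by omega) (List.getElem?_eq_getElem (by omega)))
    | c, .ptup ts cs E :: S, h =>
      rcases ts.eq_nil_or_concat with rfl | ⟨ts, t, rfl⟩
      · exact absurd (.eSea3 c cs E S) (hs _ _)
      · exact absurd (.eSea6 c _ ts t cs E S (by simp)) (hs _ _)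

/-- The interpreter begins with a representation of the initial state. -/
theorem Loaded.ready {t : Term} (h : Loaded k t) :
    interpreter.Reaches 12 k (Ready (State.init t)) := by
  obtain ⟨pc, r, m⟩ := k
  obtain ⟨rfl, ht⟩ := h
  have ht := TermIn.of_forall ht
  simp only at *
  generalize h4 : r 4 = F at *
  generalize h1 : r 1 = a at *
  iterate 12 refine Reaches.instr rfl ?_; simp [RAM.Instr.exec, *]
  refine Reaches.done ?_
  -- A single cell holding `0` serves as both the empty environment and the empty stack.
  simp [State.init, Ready, ConstRegs, StackIn, EnvIn, *]
  refine ht.extend (by omega) ?_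
  intro i hi; simp (disch := omega) only [Function.update_of_ne]

end Halting

/-! ## Amortized analysis -/

namespace Term

mutual
/-- A bound on the number of transitions, other than those that follow a beta transition, that are
due to the evaluation of a term. -/
def weight : Term → ℕ
  | var _ => 1
  | app t u => weight t + weight u + 2
  | proj _ t => weight t + 2
  | lam _ _ => 1
  | tup ts => weightList ts + 1
/-- Sum of the weights of the terms of a list, each increased by `2`. -/
def weightList : List Term → ℕ
  | [] => 0
  | t :: ts => weight t + 2 + weightList ts
end

mutual
-- The summand `1` is forced by the empty tuple, of size `0` and weight `1`. Inside a longer tuple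
-- it is absorbed, since each component adds one to the size.
theorem weight_le : ∀ t : Term, t.weight ≤ 4 * t.size + 1
  | var _ => by simp [weight, size]
  | app t u => by have := weight_le t; have := weight_le u; simp only [weight, size]; omega
  | proj _ t => by have := weight_le t; simp only [weight, size]; omega
  | lam _ _ => by simp [weight]
  | tup ts => by have := weightList_le ts; simp only [weight, size]; omega
theorem weightList_le : ∀ ts : List Term, weightList ts ≤ 4 * (ts.length + sizeList ts)
  | [] => by simp [weightList]
  | t :: ts => by
    have := weight_le t
    have := weightList_le ts
    simp only [weightList, sizeList, List.length_cons]
    omega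
end

theorem weightList_append (ts us : List Term) :
    weightList (ts ++ us) = weightList ts + weightList us := by
  induction ts with
  | nil => simp [weightList]
  | cons t ts ih => simp [weightList, ih, add_assoc]

theorem size_le_sizeList {t : Term} {ts : List Term} (h : t ∈ ts) : t.size ≤ sizeList ts := by
  induction ts with
  | nil => simp at h
  | cons u ts ih =>
    simp only [sizeList]
    rcases List.mem_cons.1 h with rfl | h
    · omega
    · have := ih h
      omega

theorem height_le_heightList {t : Term} {ts : List Term} (h : t ∈ ts) :
    t.height ≤ heightList ts := by
  induction ts with
  | nil => simp at h
  | cons u ts ih =>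
    simp only [heightList]
    rcases List.mem_cons.1 h with rfl | h
    · omega
    · have := ih h
      omega

end Term

/-- The size of `t` is at most `N`, and its height, plus the length of the environment `E`, at most
`H`. -/
def Term.Fits (N H : ℕ) (t : Term) (E : Env) : Prop := t.size ≤ N ∧ E.length + t.height ≤ H

/-- All terms in the m-closure fit, with their environments, the bounds `N` and `H`. -/
inductive EClos.Fits (N H : ℕ) : EClos → Prop where
  | abs (xs : List ℕ) (t : Term) (E : Env) (ht : (Term.lam xs t).Fits N H E)
      (hE : ∀ x c, (x, c) ∈ E → EClos.Fits N H c) : EClos.Fits N H (.abs xs t E)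
  | tup (cs : List EClos) (hcs : ∀ c ∈ cs, EClos.Fits N H c) : EClos.Fits N H (.tup cs)

/-- All m-closures in the environment fit. -/
def Env.Fits (N H : ℕ) (E : Env) : Prop := ∀ x c, (x, c) ∈ E → EClos.Fits N H c

/-- All terms in the flagged m-closure fit. -/
def FClos.Fits (N H : ℕ) : FClos → Prop
  | .ev c => c.Fits N H
  | .nev t E => t.Fits N H E ∧ E.Fits N H

/-- All terms in the stack entry fit. -/
def Entry.Fits (N H : ℕ) : Entry → Prop
  | .clos f => f.Fits N H
  | .proj _ => True
  | .ptup ts cs E => (∀ t ∈ ts, t.Fits N H E) ∧ (∀ c ∈ cs, c.Fits N H) ∧ E.Fits N H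

/-- All terms in the state fit. -/
def State.Fits (N H : ℕ) (s : State) : Prop := s.focus.Fits N H ∧ ∀ e ∈ s.stack, e.Fits N H

theorem Env.Fits.lookup {N H x : ℕ} {c : EClos} {E : Env} (hE : E.Fits N H)
    (h : E.lookup x = some c) : c.Fits N H := by
  induction E with
  | nil => simp [Env.lookup] at h
  | cons e E ih =>
    obtain ⟨y, d⟩ := e
    by_cases hy : y = x
    · obtain rfl : d = c := by simpa [Env.lookup, hy] using h
      exact hE y d (by simp)
    · exact ih (fun x c hc => hE x c (by simp [hc])) (by simpa [Env.lookup, hy] using h)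

theorem Term.Fits.of_tup {N H : ℕ} {t : Term} {ts : List Term} {E : Env}
    (h : (Term.tup ts).Fits N H E) (ht : t ∈ ts) : t.Fits N H E := by
  have h1 := Term.size_le_sizeList ht
  have h2 := Term.height_le_heightList ht
  simp only [Term.Fits, Term.size, Term.height] at h ⊢
  omega

/-- Transitions only pass to subterms, and the environment grows only in a β transition, by the
number of variables that the height loses when the abstraction is opened. -/
theorem Step.fits {N H : ℕ} {s s' : State} {a : Label} (h : Step s a s') (hs : s.Fits N H) :
    s'.Fits N H := by
  obtain ⟨hf, hS⟩ := hs
  cases h with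
  | oSea1 t u E S =>
    obtain ⟨ht, hE⟩ := hf
    simp only [Term.Fits, Term.size, Term.height] at ht
    refine ⟨⟨⟨?_, ?_⟩, hE⟩, List.forall_mem_cons.2 ⟨⟨⟨?_, ?_⟩, hE⟩, hS⟩⟩ <;> omega
  | oSea2 i t E S =>
    obtain ⟨ht, hE⟩ := hf
    simp only [Term.Fits, Term.size, Term.height] at ht
    refine ⟨⟨⟨?_, ?_⟩, hE⟩, List.forall_mem_cons.2 ⟨trivial, hS⟩⟩ <;> omega
  | oSea3 us ts t E S h =>
    subst h
    obtain ⟨ht, hE⟩ := hf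
    exact ⟨⟨ht.of_tup (by simp), hE⟩, List.forall_mem_cons.2
      ⟨⟨fun t h => ht.of_tup (by simp [h]), by simp, hE⟩, hS⟩⟩
  | oSea4 E S => exact ⟨.tup _ (by simp), hS⟩
  | oSea5 xs t E S => exact ⟨.abs xs t E hf.1 hf.2, hS⟩
  | oSub x c E S h => exact ⟨hf.2.lookup h, hS⟩
  | eSea1 c t E S =>
    rw [List.forall_mem_cons] at hS
    exact ⟨hS.1, List.forall_mem_cons.2 ⟨hf, hS.2⟩⟩
  | eSea6 c us ts t cs E S h =>
    subst h
    obtain ⟨⟨hts, hcs, hE⟩, hS⟩ := List.forall_mem_cons.1 hS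
    exact ⟨⟨hts t (by simp), hE⟩, List.forall_mem_cons.2
      ⟨⟨fun t h => hts t (by simp [h]), List.forall_mem_cons.2 ⟨hf, hcs⟩, hE⟩, hS⟩⟩
  | eSea3 c cs E S =>
    obtain ⟨⟨hts, hcs, hE⟩, hS⟩ := List.forall_mem_cons.1 hS
    exact ⟨.tup _ (List.forall_mem_cons.2 ⟨hf, hcs⟩), hS⟩
  | beta xs t E cs S h =>
    obtain ⟨hc, hS⟩ := List.forall_mem_cons.1 hS
    obtain ⟨_, _, _, ht, hE⟩ | _ := hf
    obtain _ | ⟨_, hcs⟩ := hc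
    simp only [Term.Fits, Term.size, Term.height] at ht
    refine ⟨⟨⟨by omega, ?_⟩, fun x c hx => ?_⟩, hS⟩
    · rw [List.length_append, List.length_zip]
      omega
    · rcases List.mem_append.1 hx with hx | hx
      · exact hcs c (List.of_mem_zip hx).2
      · exact hE x c hx
  | pi i cs c S hi h =>
    obtain _ | ⟨_, hcs⟩ := hf
    exact ⟨hcs c (List.mem_of_getElem? h), (List.forall_mem_cons.1 hS).2⟩

/-- The potential of a flagged m-closure. -/
def FClos.weight : FClos → ℕ
  | .ev _ => 0
  | .nev t _ => t.weight

/-- The potential of a stack entry. -/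
def Entry.weight : Entry → ℕ
  | .clos (.ev _) => 0
  | .clos (.nev t _) => t.weight + 1
  | .proj _ => 1
  | .ptup ts cs _ => Term.weightList ts + cs.length + 1

/-- The potential of a state. -/
def State.weight (s : State) : ℕ := s.focus.weight + (s.stack.map Entry.weight).sum

/-- The number of iterations of loops needed to perform a transition. -/
def Label.loops : Label → State → ℕ
  | .oSub, ⟨.nev _ E, _⟩ => E.length
  | .beta, ⟨.ev (.abs xs _ E), _⟩ => xs.length + E.length
  | .eSea3, ⟨_, .ptup _ cs _ :: _⟩ => cs.length
  | _, _ => 0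

/-- The increase in potential that a transition may cause. -/
def Label.refill (N : ℕ) (a : Label) : ℕ := if a = .beta then 4 * N + 2 else 0

/-- The amortized cost of a transition. -/
theorem Step.loops_le {N H : ℕ} {s s' : State} {a : Label} (h : Step s a s') (hs : s.Fits N H) :
    1 + a.loops s + (H + 1) * s'.weight ≤ (H + 1) * (s.weight + a.refill N) := by
  -- Either one unit of potential, worth `H + 1`, pays for the transition and at most `H`
  -- iterations, or, when a tuple is assembled, each iteration has its own unit.
  suffices a.loops s ≤ H ∧ s'.weight + 1 ≤ s.weight + a.refill N ∨
      s'.weight + 1 + a.loops s ≤ s.weight + a.refill N by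
    rcases this with ⟨h1, h2⟩ | h1
    · nlinarith
    · nlinarith
  obtain ⟨hf, hS⟩ := hs
  cases h with
  | oSub x c E S h =>
    left
    obtain ⟨ht, hE⟩ := hf
    simp only [Term.Fits, Term.size, Term.height] at ht
    simp [Label.loops, State.weight, FClos.weight, Label.refill, Term.weight]
    omega
  | eSea3 c cs E S =>
    right
    simp [Label.loops, State.weight, FClos.weight, Entry.weight, Label.refill, Term.weightList]
    omega
  | beta xs t E cs S h =>
    left
    obtain ⟨_, _, _, ht, hE⟩ | _ := hf
    have := t.weight_le
    simp only [Term.Fits, Term.size, Term.height] at ht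
    simp [Label.loops, State.weight, FClos.weight, Entry.weight, Label.refill]
    omega
  | _ =>
    left
    subst_vars
    simp [Label.loops, State.weight, FClos.weight, Entry.weight, Label.refill, Term.weight,
      Term.weightList, Term.weightList_append]
    try omega

theorem Step.continues {s s' : State} {a : Label} {k : RAM.Config} (h : Step s a s')
    (hk : Ready s k) : Continues (14 * a.loops s + 100) k (Ready s') := by
  cases h with
  | oSea1 t u E S => exact hk.app.mono (by omega)
  | oSea2 i t E S => exact hk.proj.mono (by omega)
  | oSea3 us ts t E S h => subst h; exact hk.tup.mono (by omega)
  | oSea4 E S => exact hk.nil.mono (by omega)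
  | oSea5 xs t E S => exact hk.lam.mono (by omega)
  | oSub x c E S h => exact hk.sub h
  | eSea1 c t E S => exact hk.fetch.mono (by omega)
  | eSea6 c us ts t cs E S h => subst h; exact hk.next.mono (by omega)
  | eSea3 c cs E S => exact hk.build
  | beta xs t E cs S h => exact hk.beta h
  | pi i cs c S hi h => exact (hk.pi hi h).mono (by omega)

/-- The interpreter implements a run to a final state. -/
theorem Run.implemented {N H : ℕ} {s s' : State} (ρ : Run s s') (hs' : s'.Final) :
    ∀ {k : RAM.Config}, s.Fits N H → Ready s k → ∃ τ : ℕ → ℕ,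
      (∀ i < ρ.length, τ i < τ (i + 1)) ∧
      (∀ (i : ℕ) (r : State), ρ.states[i]? = some r →
        Represents (interpreter.after (τ i) k) r) ∧
      interpreter.Halted (interpreter.after (τ ρ.length) k) ∧
      τ ρ.length ≤ 101 * ((H + 1) * (s.weight + (4 * N + 2) * ρ.numBeta)) + (14 * H + 101) := by
  induction ρ with
  | nil s =>
    intro k hs hk
    obtain ⟨B, hB, hB', hend⟩ := hk.stops hs'
    obtain ⟨n, -, hn, h⟩ := hend.pos_of_step
    -- The time assigned to the final state is that of halting, not of arrival, since the program
    -- must have stopped by then.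
    refine ⟨fun _ => n, by simp [Run.length], fun i r hi => ?_, h.halted, ?_⟩
    · obtain rfl : s = r := by
        rw [Run.states] at hi
        exact (List.mem_singleton.1 (List.mem_of_getElem? hi)).symm
      exact h.represents hk.represents
    · change n ≤ _
      obtain ⟨c | ⟨t, E⟩, S⟩ := s
      · have := hB' _ _ rfl
        omega
      · have := hB _ _ _ rfl
        have := hs.1.1.2
        omega
  | cons a h ρ ih =>
    rename_i s₁ s₂ s₃
    intro k hs hk
    obtain ⟨n, hn, hn', hk'⟩ := (h.continues hk).pos_of_step
    obtain ⟨τ, h1, h2, h3, h4⟩ := ih hs' (h.fits hs) hk'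
    refine ⟨fun i => if i = 0 then 0 else n + τ (i - 1), fun i hi => ?_, fun i r hi => ?_, ?_, ?_⟩
    · rcases i with _ | i
      · simp; omega
      · simpa using h1 i (by simpa [Run.length] using hi)
    · rcases i with _ | i
      · obtain rfl : s₁ = r := by simpa [Run.states] using hi
        exact hk.represents
      · simpa [after_add] using h2 i r (by simpa [Run.states] using hi)
    · simpa [Run.length, after_add] using h3
    -- The transition takes at most `14 * loops + 101` steps, hence at most `101 * (1 + loops)`,
    -- which the amortized inequality bounds.
    · have hle := h.loops_le hs
      have hb : (4 * N + 2) * (ρ.cons a h).numBeta = (4 * N + 2) * ρ.numBeta + a.refill N := by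
        simp only [Run.numBeta, Label.refill]
        split_ifs <;> ring
      rw [hb]
      simp only [Run.length, Nat.add_sub_cancel, Nat.add_one_ne_zero, if_false]
      nlinarith

end SourceTAM

-- The time bound

theorem mainTheorem8 :
    ∃ (P : RAM.Program) (K : ℕ), ∀ t : SourceTAM.Term, t.Distinct → t.Closed →
      ∀ (s : SourceTAM.State) (ρ : SourceTAM.Run (SourceTAM.State.init t) s), s.Final →
        SourceTAM.ImplementsWithin P ρ
          (K * ((ρ.numBeta + 1) * max 1 t.size * max 1 t.height)) := by
  -- With `X` the product in the bound, set-up, run and halting take at most `12 + 101 * 12 * X + 14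
  -- * X + 101` steps, and `X ≥ 1`; so `2000` is ample.
  refine ⟨SourceTAM.interpreter, 2000, fun t _ _ s ρ hs k hk => ?_⟩
  obtain ⟨n, hn, hr⟩ := SourceTAM.Loaded.ready hk
  obtain ⟨τ, h1, h2, h3, h4⟩ := ρ.implemented (N := t.size) (H := t.height) hs
    ⟨⟨⟨le_rfl, by simp⟩, by simp [SourceTAM.Env.Fits]⟩, by simp [SourceTAM.State.init]⟩ hr
  refine ⟨fun i => n + τ i, fun i hi => by simpa using h1 i hi, fun i r hi => ?_, ?_, ?_⟩
  · rw [RAM.Program.after_add]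
    exact h2 i r hi
  · rwa [RAM.Program.after_add]
  · refine (Nat.add_le_add hn h4).trans ?_
    have hw : (SourceTAM.State.init t).weight ≤ 4 * t.size + 1 := by
      simpa [SourceTAM.State.init, SourceTAM.State.weight, SourceTAM.FClos.weight] using t.weight_le
    generalize ρ.numBeta = b at *
    generalize hN : max 1 t.size = N'
    generalize hH : max 1 t.height = H'
    -- The initial weight is at most `4 * N' + 2`, the bound on each β refill as well, and `2 ≤ 2 *
    -- N'`.
    have hA : (SourceTAM.State.init t).weight + (4 * t.size + 2) * b ≤ 6 * ((b + 1) * N') := by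
      nlinarith [Nat.zero_le b, show t.size ≤ N' by omega, show 1 ≤ N' by omega]
    have hB : (t.height + 1) * ((SourceTAM.State.init t).weight + (4 * t.size + 2) * b) ≤
        2 * H' * (6 * ((b + 1) * N')) := Nat.mul_le_mul (by omega) hA
    have hC : H' ≤ (b + 1) * N' * H' :=
      Nat.le_mul_of_pos_left _ (Nat.mul_pos (by omega) (by omega))
    have : 2 * H' * (6 * ((b + 1) * N')) = 12 * ((b + 1) * N' * H') := by ring
    omega
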